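/- For $z$ in the upper half plane put $q=e^{2\pi i z}$, and let $E_2,E_4,E_6$ be the normalized Eisenstein series of weights $2,4,6$ for $\mathrm{SL}_2(\mathbb Z)$ and $\Delta=q\prod_{n\ge1}(1-q^n)^{24}$. For integers $\ell,w\ge 0$ let $\widetilde M_{\ell,w}$ be the space of functions $\sum_{j=0}^{\ell} f_jE_2^j$, where $f_j$ is a modular form of weight $w-2j$ for $\mathrm{SL}_2(\mathbb Z)$. A form $f=\sum_{n\ge0}a_nq^n$ in $\widetilde M_{\ell,w}$ but not in $\widetilde M_{\ell',w}$ for any $\ell'<\ell$ is called normalized extremal of depth $\ell$ and weight $w$ if, with $m=\dim_{\mathbb C}\widetilde M_{\ell,w}$, one has $a_0=\dots=a_{m-2}=0$ and $a_{m-1}=1$. For every integer $k\ge0$ there is exactly one normalized extremal form $\widetilde f_{1,6k+2}$ of depth $1$ and weight $6k+2$. Let $\Delta^{1/2}=q^{1/2}(1+\cdots)$ and $E_4^{1/2}=1+\cdots$ be the normalized square roots in $\mathbb C((q^{1/2}))$, and put $$\varphi_k=\widetilde f_{1,6k+2}\,\Delta^{-k/2}E_4^{-1/2}\in\mathbb C((q^{1/2})),\qquad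 \mu^*_k=\frac{12(6k-1)(6k+7)}{k(k+1)},\qquad \Psi(\mu)=\psi^2+\mu\Big(\frac{E_6}{\Delta^{1/2}}\,\psi-1\Big),$$ where $\psi$ is the shift $k\mapsto k+1$ and $\mu=\mu(k)$ acts by multiplication. Then $\Psi\big((\mu^*_{k+1})^{-1}\big)(\varphi)=0$, in both of the following senses. (a) For the family $\varphi=(\varphi_k)_{k\ge0}$, with $(\psi\varphi)_k=\varphi_{k+1}$: for every integer $k\ge0$, $$\varphi_{k+2}+(\mu^*_{k+1})^{-1}\Big(\frac{E_6}{\Delta^{1/2}}\,\varphi_{k+1}-\varphi_k\Big)=0\quad\text{in }\mathbb C((q^{1/2})).$$ (b) There is exactly one sequence of rational functions $\alpha_n\in\mathbb Q(k)$, $n\ge0$, without poles at the integers $k\ge0$, such that $\varphi_k=q^{k/2}\sum_{n\ge0}\alpha_n(k)q^n$ for every integer $k\ge0$. Now let $k$ be an indeterminate, and regard $\varphi=q^{k/2}\sum_{n\ge0}\alpha_n(k)q^n$ as an element of the formal space $q^{k/2}\,\mathbb C(k)((q^{1/2}))$, on which $\psi$ acts by $\psi\big(q^{k/2}\sum_n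 c_n(k)q^{n/2}\big)=q^{(k+1)/2}\sum_n c_n(k+1)q^{n/2}$. Then $\Psi\big((\mu^*_{k+1})^{-1}\big)(\varphi)=0$ in this space. -/

import Mathlib

open UpperHalfPlane hiding I
open scoped MatrixGroups

noncomputable section

/-! ### Quasimodular forms on `SL(2, ℤ)` -/

/-- The space of quasimodular forms of weight `w` and depth at most `ℓ`: the functions
`f = ∑_{j ≤ ℓ} f_j E₂ ^ j` with `f_j` a modular form of weight `w - 2 j` for `SL(2, ℤ)`. -/
def QuasimodularForms (ℓ w : ℕ) : Submodule ℂ (ℍ → ℂ) where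
  carrier := {f | ∃ g : (j : ℕ) → ModularForm 𝒮ℒ ((w : ℤ) - 2 * (j : ℤ)),
    ∀ z, f z = ∑ j ∈ Finset.range (ℓ + 1), g j z * EisensteinSeries.E2 z ^ j}
  add_mem' := by
    rintro f₁ f₂ ⟨g₁, h₁⟩ ⟨g₂, h₂⟩
    refine ⟨fun j => g₁ j + g₂ j, fun z => ?_⟩
    simp [h₁, h₂, add_mul, Finset.sum_add_distrib]
  zero_mem' := ⟨fun _ => 0, fun z => by simp⟩
  smul_mem' := by
    rintro c f ⟨g, h⟩
    refine ⟨fun j => c • g j, fun z => ?_⟩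
    simp [h, Finset.mul_sum, mul_assoc]

/-- `f` is a normalized extremal quasimodular form of depth `ℓ` and weight `w`: it has depth exactly
`ℓ`, and its `q`-expansion is `q ^ (m - 1) + O(q ^ m)`, with `m` the dimension of the space of
quasimodular forms of weight `w` and depth at most `ℓ`. -/
structure IsNormalizedExtremal (ℓ w : ℕ) (f : ℍ → ℂ) : Prop where
  mem : f ∈ QuasimodularForms ℓ w
  notMem : ∀ l < ℓ, f ∉ QuasimodularForms l w
  coeff_eq_zero : ∀ n : ℕ, n + 1 < Module.finrank ℂ (QuasimodularForms ℓ w) →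
    (qExpansion 1 f).coeff n = 0
  coeff_eq_one : (qExpansion 1 f).coeff (Module.finrank ℂ (QuasimodularForms ℓ w) - 1) = 1

/-! ### Formal series in `t = q ^ (1 / 2)` -/

section FormalSeries

variable {K : Type*} [Field K]

/-- The coefficients of the square root, with constant coefficient `1`, of a power series with
constant coefficient `1`. -/
def sqrtCoeff (f : PowerSeries K) : ℕ → K
  | 0 => 1
  | n + 1 => (f.coeff (n + 1) - ∑ i : Fin n, sqrtCoeff f (i + 1) * sqrtCoeff f (n - i)) / 2

/-- The square root, with constant coefficient `1`, of a power series with constant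
coefficient `1`. -/
def normSqrt (f : PowerSeries K) : PowerSeries K := PowerSeries.mk (sqrtCoeff f)

lemma coeff_zero_normSqrt (f : PowerSeries K) : (normSqrt f).coeff 0 = 1 := by
  simp [normSqrt, sqrtCoeff]

lemma normSqrt_sq [CharZero K] (f : PowerSeries K) (hf : f.coeff 0 = 1) :
    normSqrt f ^ 2 = f := by
  ext n
  cases n with
  | zero => simp [sq, PowerSeries.coeff_mul, normSqrt, sqrtCoeff, hf]
  | succ n =>
    have h2 : (2 : K) ≠ 0 := two_ne_zero
    rw [sq, PowerSeries.coeff_mul,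
      Finset.Nat.sum_antidiagonal_eq_sum_range_succ
        (fun i j => (normSqrt f).coeff i * (normSqrt f).coeff j), Finset.sum_range_succ',
      Finset.sum_range_succ]
    simp only [normSqrt, PowerSeries.coeff_mk]
    have e : ∑ i ∈ Finset.range n, sqrtCoeff f (i + 1) * sqrtCoeff f (n + 1 - (i + 1)) =
        ∑ i : Fin n, sqrtCoeff f (i + 1) * sqrtCoeff f (n - i) := by
      rw [Finset.sum_range]
      refine Finset.sum_congr rfl fun i _ => ?_
      congr 2
      omega
    rw [e]
    have h0 : sqrtCoeff f 0 = 1 := by rw [sqrtCoeff]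
    have h1 : sqrtCoeff f (n + 1) = (f.coeff (n + 1) -
      ∑ i : Fin n, sqrtCoeff f (i + 1) * sqrtCoeff f (n - i)) / 2 := by rw [sqrtCoeff]
    simp only [Nat.sub_self, Nat.sub_zero, h0, h1]
    field_simp
    ring

/-- A power series in `q`, seen as a Laurent series in `t = q ^ (1 / 2)` through `q = t ^ 2`. -/
def inHalfPowers (f : PowerSeries K) : LaurentSeries K :=
  HahnSeries.ofPowerSeries ℤ K (PowerSeries.expand 2 two_ne_zero f)

/-- `μ*_x = 12 (6 x - 1) (6 x + 7) / (x (x + 1))`. -/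
def muStar (x : K) : K := 12 * (6 * x - 1) * (6 * x + 7) / (x * (x + 1))

end FormalSeries

/-- `E₄ ^ (1 / 2)`, a Laurent series in `t = q ^ (1 / 2)`. -/
def sqrtE₄ : LaurentSeries ℂ := inHalfPowers (normSqrt (qExpansion 1 ModularForm.E₄))

/-- `Δ ^ (1 / 2) = q ^ (1 / 2) (Δ / q) ^ (1 / 2)`, a Laurent series in `t = q ^ (1 / 2)`. -/
def sqrtDelta : LaurentSeries ℂ :=
  HahnSeries.single 1 1 * inHalfPowers (normSqrt
    (PowerSeries.mk fun n => (qExpansion 1 ModularForm.discriminant).coeff (n + 1)))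

/-- `E₆ Δ ^ (-1 / 2)`, a Laurent series in `t = q ^ (1 / 2)`. -/
def E₆DivSqrtDelta : LaurentSeries ℂ := inHalfPowers (qExpansion 1 ModularForm.E₆) * sqrtDelta⁻¹

/-- `f Δ ^ (-k / 2) E₄ ^ (-1 / 2)`, a Laurent series in `t = q ^ (1 / 2)`. -/
def phiSeries (f : ℍ → ℂ) (k : ℕ) : LaurentSeries ℂ :=
  inHalfPowers (qExpansion 1 f) * (sqrtDelta⁻¹) ^ k * sqrtE₄⁻¹

/-! ### The operator `Ψ(μ) = ψ² + μ (h ψ - 1)` -/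

/-- `Ψ(μ) = ψ² + μ (h ψ - 1)` applied to `φ`, for an operator `ψ` on a ring `A` and elements `h`
and `μ` of `A` that act by multiplication. -/
def opPsi {A : Type*} [Ring A] (ψ : A → A) (h μ φ : A) : A := ψ (ψ φ) + μ * (h * ψ φ - φ)

/-- The shift `k ↦ k + 1` on families of Laurent series indexed by `k ∈ ℕ`. -/
def shiftFamily (φ : ℕ → LaurentSeries ℂ) : ℕ → LaurentSeries ℂ := fun k => φ (k + 1)

/-- The automorphism `k ↦ k + 1` of the field `ℂ(k)` (the variable `k` is `RatFunc.X`). -/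
def shiftRatFunc : RatFunc ℂ →+* RatFunc ℂ :=
  RatFunc.mapRingHom (Polynomial.taylorAlgHom (1 : ℂ))
    (nonZeroDivisors_le_comap_nonZeroDivisors_of_injective _ (Polynomial.taylor_injective (1 : ℂ)))

/-- The inclusion `ℚ(k) → ℂ(k)`. -/
def ratFuncInclusion : RatFunc ℚ →+* RatFunc ℂ :=
  RatFunc.mapRingHom (Polynomial.mapRingHom (algebraMap ℚ ℂ))
    (nonZeroDivisors_le_comap_nonZeroDivisors_of_injective _
      (Polynomial.map_injective _ (algebraMap ℚ ℂ).injective))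

/-- The shift `k ↦ k + 1` on `q ^ (k / 2) ℂ(k)((q ^ (1 / 2)))`. An element `q ^ (k / 2) g` of this
space is represented by `g`; it is sent to `q ^ ((k + 1) / 2) g(k + 1)`, which is represented by
`t g(k + 1)`, where `g(k + 1)` is `g` with `k ↦ k + 1` applied to each coefficient. -/
def shiftFormal (g : LaurentSeries (RatFunc ℂ)) : LaurentSeries (RatFunc ℂ) :=
  HahnSeries.single 1 1 * g.map shiftRatFunc

/-- A Laurent series with constant coefficients, seen over `ℂ(k)`. -/
def constSeries (g : LaurentSeries ℂ) : LaurentSeries (RatFunc ℂ) :=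
  g.map (RatFunc.C : ℂ →+* RatFunc ℂ)

/-- The rational functions `α n ∈ ℚ(k)` have no pole at any `k ∈ ℕ`, and their values at `k` are the
coefficients in `φ k = q ^ (k / 2) ∑ n, α n (k) q ^ n`. -/
def IsRationalExpansion (φ : ℕ → LaurentSeries ℂ) (α : ℕ → RatFunc ℚ) : Prop :=
  ∀ k : ℕ, (∀ n, (α n).denom.eval (k : ℚ) ≠ 0) ∧
    φ k = HahnSeries.single (k : ℤ) 1 *
      inHalfPowers (PowerSeries.mk fun n => (α n).eval (algebraMap ℚ ℂ) (k : ℂ))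

/-- The element `q ^ (k / 2) ∑ n, α n q ^ n` of `q ^ (k / 2) ℂ(k)((q ^ (1 / 2)))`, represented by its
second factor. -/
def formalSeries (α : ℕ → RatFunc ℚ) : LaurentSeries (RatFunc ℂ) :=
  inHalfPowers (PowerSeries.mk fun n => ratFuncInclusion (α n))

end

/-! Put `D = 12 q d/dq`, `M = 6k`, `P = E₂`, `Q = E₄`, `T = E₆/E₄`. The function `φ_k` is the
solution `q^{k/2}(1 + O(q))` of the Kaneko–Zagier equation `D²φ = (M²Q - 12Q + 12T²)φ`. For `n ≥ 1`
its indicial factor is `144 n(n + k)`, so when `k` is no negative integer a solution in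
`q^{k/2}K[[q]]` is determined up to a scalar. This makes sense for `k` in any field `K` of
characteristic zero, and `phiTail` is that solution without its factor `q^{k/2}`.

Two consequences of Ramanujan's identities carry the proof. The first order operator `lowering`
sends solutions for `k + 1` to solutions for `k`; comparing constant terms, it sends `φ_{k+1}` to
`12(k+1)φ_k` (`lowering_phiTail`). Given this, with `h = E₆Δ^{-1/2}`, the combination `φ_k -
hφ_{k+1}` solves the equation for `k + 2` (`isKZSolution_sub`). Its term in `q^{k/2}` cancels, so it
is a multiple of `φ_{k+2}`, and the next coefficient shows that the factor is `μ*_{k+1}`. This is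
`phiTail_sub`; (a) is the case `κ = k` in `ℂ`, and (b) is the case where `κ` is the variable of
`ℂ(k)`.

It remains to identify the extremal forms with these solutions. The recursion `μ*_{k+1}f_{k+2} =
Δf_k - E₆f_{k+1}`, started at `E₂` and `(E₄² - E₆E₂)/1008`, produces quasimodular forms `f_k` of
depth at most 1, and `phiTail_sub` shows `f_k = q^k + O(q^{k+1})`. A determinant argument
(`eq_zero_of_X_pow_succ_dvd`) shows that a form of this weight and depth that is `O(q^{k+1})`
vanishes. Hence the dimension is `k + 1`, and `f_k` is the unique normalized extremal form.

Finally, the Frobenius recursion makes every coefficient of `phiTail` a rational function of `κ`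
over `ℚ`, with denominators built from factors `n + 1 + κ`. This gives the `α_n`, and infinitely
many values determine them. -/

/-! ### The Kaneko–Zagier equation in an abstract differential ring -/

section DifferentialRing

variable {k A : Type*} [CommRing k] [CommRing A] [Algebra k A]
  {D : Derivation k A A} {P Q T U Z σ M : A}

/-- `y` satisfies `(D + σ)² y = (M² Q - 12 Q + 12 T²) y`, expanded for a constant `σ`. -/
def IsKZSolution (D : Derivation k A A) (Q T σ M y : A) : Prop :=
  D (D y) + 2 * σ * D y + σ ^ 2 * y = (M ^ 2 * Q - 12 * Q + 12 * T ^ 2) * y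

/-- The differential relations between `P = E₂`, `Q = E₄`, `T = E₆ / E₄` and `U = (Δ / q) ^ (-1/2)`
for `D = 12 q d/dq`. -/
structure IsRamanujan (D : Derivation k A A) (P Q T U Z : A) : Prop where
  dP : D P = P ^ 2 - Q
  dQ : D Q = 4 * Q * (P - T)
  dT : D T = 2 * P * T - 6 * Q + 4 * T ^ 2
  dU : D U = -6 * (P - 1) * U
  dZ : D Z = -2 * (P - T) * Z

/-- The operator that lowers the parameter `M` of a solution by `6`. -/
def lowering (D : Derivation k A A) (P Q T U M g : A) : A :=
  U * Q * (D g + (M + P + (M - 1) * T) * g)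

lemma isKZSolution_lowering (h : IsRamanujan D P Q T U Z) (hM : D M = 0) {g : A}
    (hg : IsKZSolution D Q T M M g) :
    IsKZSolution D Q T (M - 6) (M - 6) (lowering D P Q T U M g) := by
  unfold IsKZSolution at *
  have h2 : D (D g) = (M ^ 2 * Q - 12 * Q + 12 * T ^ 2) * g - 2 * M * D g - M ^ 2 * g := by
    linear_combination hg
  have n6 : D (6 : A) = 0 := D.map_natCast 6
  have n4 : D (4 : A) = 0 := D.map_natCast 4
  have n12 : D (12 : A) = 0 := D.map_natCast 12
  have n2 : D (2 : A) = 0 := D.map_natCast 2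
  simp only [lowering, Derivation.leibniz, map_add, map_sub, map_neg, smul_eq_mul, h.dP, h.dQ,
      h.dT, h.dU, hM,
    h2, Derivation.leibniz_pow, nsmul_eq_mul, n6, n4, n12, n2, D.map_one_eq_zero, map_zero]
  push_cast
  ring

/-- The starting solution `φ_0 = E₂E₄^{-1/2}`, of exponent 0. -/
lemma isKZSolution_zero (h : IsRamanujan D P Q T U Z) :
    IsKZSolution D Q T 0 0 (P * Z) := by
  have n2 : D (2 : A) = 0 := D.map_natCast 2
  simp only [IsKZSolution, Derivation.leibniz, map_add, map_sub, map_neg, smul_eq_mul, h.dP, h.dQ,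
    h.dT, h.dZ, Derivation.leibniz_pow, nsmul_eq_mul, n2]
  push_cast
  ring

/-- The starting solution `1008 φ_1 = (E₄² - E₆E₂)Δ^{-1/2}E₄^{-1/2}`. Since `Δ^{-1/2} = q^{-1/2}U`
and `D q^{-1/2} = -6 q^{-1/2}`, removing `q^{-1/2}` leaves `σ = -6`, while the potential has `M =
6`. -/
lemma isKZSolution_one (h : IsRamanujan D P Q T U Z) :
    IsKZSolution D Q T (-6) 6 (Q * (Q - T * P) * U * Z) := by
  have n6 : D (6 : A) = 0 := D.map_natCast 6
  have n4 : D (4 : A) = 0 := D.map_natCast 4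
  have n2 : D (2 : A) = 0 := D.map_natCast 2
  simp only [IsKZSolution, Derivation.leibniz, map_add, map_sub, map_neg, smul_eq_mul, h.dP, h.dQ,
    h.dT, h.dU, h.dZ, Derivation.leibniz_pow, nsmul_eq_mul, n2, n4, n6, D.map_one_eq_zero]
  push_cast
  ring

/-- The potentials at `M + 6` and `M - 6` differ by `24MQ`, and `24MQ g = 12Q · lowering(g')`. This
first order expression in `g'` is what `D²` produces from the product `hg'` with `h = E₆Δ^{-1/2}`,
because `Dh = -6E₄²Δ^{-1/2}`. -/
lemma isKZSolution_sub (h : IsRamanujan D P Q T U Z) {g g' : A}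
    (hg : IsKZSolution D Q T (M - 6) (M - 6) g) (hg' : IsKZSolution D Q T M M g')
    (hl : lowering D P Q T U M g' = 2 * M * g) :
    IsKZSolution D Q T (M - 6) (M + 6) (g - Q * T * U * g') := by
  unfold IsKZSolution at *
  have h2 : D (D g') = (M ^ 2 * Q - 12 * Q + 12 * T ^ 2) * g' - 2 * M * D g' - M ^ 2 * g' := by
    linear_combination hg'
  have n6 : D (6 : A) = 0 := D.map_natCast 6
  have n4 : D (4 : A) = 0 := D.map_natCast 4
  have n2 : D (2 : A) = 0 := D.map_natCast 2
  simp only [lowering] at hl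
  simp only [Derivation.leibniz, map_add, map_sub, map_neg, smul_eq_mul, h.dP, h.dQ, h.dT,
    h.dU, h2, Derivation.leibniz_pow, nsmul_eq_mul, n6, n4, n2, D.map_one_eq_zero]
  push_cast
  linear_combination hg + (12 * Q) * hl

end DifferentialRing

/-! ### q-expansions of holomorphic periodic functions, and Ramanujan's identities -/

section QSeries

open Function Complex Manifold
open scoped ModularForm

/-- `f` is holomorphic on the upper half plane, of period `1`, and bounded at the cusp. -/
structure IsHolomorphicAtCusp (f : ℍ → ℂ) : Prop where
  periodic : Periodic (f ∘ ofComplex) 1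
  mdiff : MDiff f
  bounded : IsBoundedAtImInfty f

namespace IsHolomorphicAtCusp

variable {f g : ℍ → ℂ}

lemma periodic' (hf : IsHolomorphicAtCusp f) : Periodic (f ∘ ofComplex) (1 : ℝ) := by
  simpa using hf.periodic

lemma analyticAt (hf : IsHolomorphicAtCusp f) : AnalyticAt ℂ (cuspFunction 1 f) 0 :=
  analyticAt_cuspFunction_zero one_pos hf.periodic' hf.mdiff hf.bounded

lemma add (hf : IsHolomorphicAtCusp f) (hg : IsHolomorphicAtCusp g) :
    IsHolomorphicAtCusp (f + g) :=
  ⟨hf.periodic.add hg.periodic, hf.mdiff.add hg.mdiff, hf.bounded.add hg.bounded⟩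

lemma mul (hf : IsHolomorphicAtCusp f) (hg : IsHolomorphicAtCusp g) :
    IsHolomorphicAtCusp (f * g) :=
  ⟨hf.periodic.mul hg.periodic, hf.mdiff.mul hg.mdiff, hf.bounded.mul hg.bounded⟩

lemma const (c : ℂ) : IsHolomorphicAtCusp (fun _ => c) :=
  ⟨fun _ => rfl, mdifferentiable_const, Filter.const_boundedAtFilter _ _⟩

lemma smul (hf : IsHolomorphicAtCusp f) (c : ℂ) : IsHolomorphicAtCusp (c • f) :=
  (const c).mul hf

lemma sub (hf : IsHolomorphicAtCusp f) (hg : IsHolomorphicAtCusp g) :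
    IsHolomorphicAtCusp (f - g) := by
  simpa [sub_eq_add_neg] using hf.add (hg.smul (-1))

lemma of_modularForm {F : Type*} [FunLike F ℍ ℂ] {k : ℤ} [ModularFormClass F 𝒮ℒ k] (f : F) :
    IsHolomorphicAtCusp f :=
  have : Fact (IsCusp OnePoint.infty 𝒮ℒ) :=
    ⟨Subgroup.isCusp_of_mem_strictPeriods one_pos one_mem_strictPeriods_SL⟩
  ⟨by simpa using SlashInvariantFormClass.periodic_comp_ofComplex f one_mem_strictPeriods_SL,
    ModularFormClass.holo f, ModularFormClass.bdd_at_infty f⟩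

lemma qExpansion_mul (hf : IsHolomorphicAtCusp f) (hg : IsHolomorphicAtCusp g) :
    qExpansion 1 (f * g) = qExpansion 1 f * qExpansion 1 g :=
  UpperHalfPlane.qExpansion_mul hf.analyticAt hg.analyticAt

lemma qExpansion_add (hf : IsHolomorphicAtCusp f) (hg : IsHolomorphicAtCusp g) :
    qExpansion 1 (f + g) = qExpansion 1 f + qExpansion 1 g :=
  UpperHalfPlane.qExpansion_add hf.analyticAt hg.analyticAt

lemma qExpansion_sub (hf : IsHolomorphicAtCusp f) (hg : IsHolomorphicAtCusp g) :
    qExpansion 1 (f - g) = qExpansion 1 f - qExpansion 1 g :=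
  UpperHalfPlane.qExpansion_sub hf.analyticAt hg.analyticAt

lemma qExpansion_smul (hf : IsHolomorphicAtCusp f) (c : ℂ) :
    qExpansion 1 (c • f) = c • qExpansion 1 f :=
  UpperHalfPlane.qExpansion_smul hf.analyticAt c

lemma eq_zero_iff (hf : IsHolomorphicAtCusp f) : qExpansion 1 f = 0 ↔ f = 0 :=
  qExpansion_eq_zero_iff one_pos hf.periodic' hf.mdiff hf.bounded

lemma coeff_unique (hf : IsHolomorphicAtCusp f) {c : ℕ → ℂ}
    (h : ∀ τ : ℍ, HasSum (fun m => c m • Periodic.qParam 1 τ ^ m) (f τ)) (m : ℕ) :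
    (qExpansion 1 f).coeff m = c m := by
  have h1 := (hasFPowerSeriesOnBall_cuspFunction one_pos hf.analyticAt h).hasFPowerSeriesAt
  have h2 := congr_arg (FormalMultilinearSeries.coeff · m)
    (h1.eq_formalMultilinearSeries hf.analyticAt.hasFPowerSeriesAt)
  simp only [FormalMultilinearSeries.coeff_ofScalars] at h2
  rw [h2, qExpansion_coeff, div_eq_inv_mul]

-- With `F` the function of `q` that induces `f`, the chain rule turns `(2πi)⁻¹ d/dz` into `q
-- F'(q)`. The Taylor series of `F'` on the unit disc then gives the expansion.
open Derivative in
lemma hasSum_deriv (hf : IsHolomorphicAtCusp f) (τ : ℍ) :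
    HasSum (fun m : ℕ => ((m : ℂ) * (qExpansion 1 f).coeff m) • Periodic.qParam 1 τ ^ m)
      (normalizedDerivOfComplex f τ) := by
  set F := cuspFunction 1 f
  set q := Periodic.qParam 1 τ with hq
  have hq1 : q ∈ Metric.ball (0 : ℂ) 1 := by
    simpa using Periodic.norm_qParam_lt_one one_pos τ.im_pos
  have hF : DifferentiableOn ℂ F (Metric.ball 0 1) :=
    differentiableOn_cuspFunction_ball one_pos hf.periodic' hf.mdiff hf.bounded
  have hcomp : f ∘ ofComplex = F ∘ Periodic.qParam 1 :=
    funext fun z => (Periodic.eq_cuspFunction one_ne_zero hf.periodic' z).symm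
  have hD : normalizedDerivOfComplex f τ = q * deriv F q := by
    have h1 : HasDerivAt (Periodic.qParam 1) (q * (2 * Real.pi * I)) (τ : ℂ) := by
      have h0 : HasDerivAt (fun z : ℂ => 2 * Real.pi * I * z) (2 * Real.pi * I) (τ : ℂ) := by
        simpa using (hasDerivAt_id (τ : ℂ)).const_mul (2 * Real.pi * I)
      have := h0.cexp
      have e : Periodic.qParam 1 = fun z : ℂ => cexp (2 * Real.pi * I * z) := by
        ext z; simp [Periodic.qParam]
      rw [hq, e]
      exact this
    have h2 : HasDerivAt F (deriv F q) q :=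
      (hF.differentiableAt (Metric.isOpen_ball.mem_nhds hq1)).hasDerivAt
    have h3 : deriv (F ∘ Periodic.qParam 1) (τ : ℂ) = deriv F q * (q * (2 * Real.pi * I)) :=
      (h2.comp (τ : ℂ) h1).deriv
    rw [normalizedDerivOfComplex, hcomp, h3]
    field_simp [Real.pi_ne_zero]
  have hs := (Complex.hasSum_taylorSeries_on_ball (hF.deriv Metric.isOpen_ball) hq1).mul_left q
  rw [← hD] at hs
  rw [← hasSum_nat_add_iff' 1]
  simp only [Finset.range_one, Finset.sum_singleton, Nat.cast_zero, zero_mul, zero_smul, sub_zero]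
  refine hs.congr_fun fun n => ?_
  rw [qExpansion_coeff, ← iteratedDeriv_succ', Nat.factorial_succ]
  have : ((n : ℂ) + 1) ≠ 0 := Nat.cast_add_one_ne_zero n
  push_cast
  simp only [smul_eq_mul, sub_zero, F]
  field_simp
  ring

lemma deriv (hf : IsHolomorphicAtCusp f) :
    IsHolomorphicAtCusp (Derivative.normalizedDerivOfComplex f) := by
  refine ⟨?_, Derivative.normalizedDerivOfComplex_mdifferentiable hf.mdiff,
    isBoundedAtImInfty_of_hasSum_qExpansion one_pos hf.hasSum_deriv⟩
  intro w
  by_cases hw : 0 < w.im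
  · have hw' : 0 < (w + 1).im := by simpa using hw
    have e : ∀ (z : ℂ) (hz : 0 < z.im), (Derivative.normalizedDerivOfComplex f ∘ ofComplex) z =
        (2 * Real.pi * I)⁻¹ * _root_.deriv (f ∘ ofComplex) z := by
      intro z hz
      simp [Derivative.normalizedDerivOfComplex, ofComplex_apply_of_im_pos hz]
    rw [e _ hw, e _ hw', ← deriv_comp_add_const, funext hf.periodic]
  -- Off the upper half plane `ofComplex` takes one fixed value, so periodicity there is trivial.
  · have hw' : (w + 1).im ≤ 0 := by simpa using hw
    simp [ofComplex_apply_of_im_nonpos hw', ofComplex_apply_of_im_nonpos (not_lt.mp hw)]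

lemma coeff_qExpansion_deriv (hf : IsHolomorphicAtCusp f) (n : ℕ) :
    (qExpansion 1 (Derivative.normalizedDerivOfComplex f)).coeff n =
      n * (qExpansion 1 f).coeff n :=
  hf.deriv.coeff_unique hf.hasSum_deriv n

end IsHolomorphicAtCusp

lemma hasSum_qParam_E2 (z : ℍ) :
    HasSum (fun m : ℕ => (if m = 0 then 1 else -24 * ArithmeticFunction.sigma 1 m : ℂ) •
      Periodic.qParam 1 z ^ m) (EisensteinSeries.E2 z) := by
  simpa [Periodic.qParam] using EisensteinSeries.hasSum_qExpansion_E2 (z := z)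

lemma isHolomorphicAtCusp_E2 : IsHolomorphicAtCusp EisensteinSeries.E2 := by
  refine ⟨?_, E2_mdifferentiable, EisensteinSeries.isBoundedAtImInfty_E2⟩
  intro w
  by_cases hw : 0 < w.im
  · have hw' : 0 < (w + 1).im := by simpa using hw
    simp only [Function.comp_apply, ofComplex_apply_of_im_pos hw, ofComplex_apply_of_im_pos hw']
    refine (hasSum_qParam_E2 _).unique ?_
    have e : Periodic.qParam 1 (w + 1) = Periodic.qParam 1 w := by
      simp [Periodic.qParam, mul_add, exp_add]
    simpa only [UpperHalfPlane.coe_mk, e] using hasSum_qParam_E2 ⟨w, hw⟩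
  · have hw' : (w + 1).im ≤ 0 := by simpa using hw
    simp [ofComplex_apply_of_im_nonpos hw', ofComplex_apply_of_im_nonpos (not_lt.mp hw)]

lemma coeff_qExpansion_E2 (n : ℕ) : (qExpansion 1 EisensteinSeries.E2).coeff n =
    if n = 0 then 1 else -24 * (ArithmeticFunction.sigma 1 n : ℂ) :=
  isHolomorphicAtCusp_E2.coeff_unique hasSum_qParam_E2 n

/-- `f` is a modular form of weight `k` for `SL(2, ℤ)`. -/
def IsModular (k : ℤ) (f : ℍ → ℂ) : Prop := ∃ g : ModularForm 𝒮ℒ k, ⇑g = f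

namespace IsModular

variable {k l : ℤ} {f g : ℍ → ℂ}

lemma holo (hf : IsModular k f) : IsHolomorphicAtCusp f := by
  obtain ⟨f, rfl⟩ := hf
  exact .of_modularForm f

lemma of_slash (hf : IsHolomorphicAtCusp f) (h : ∀ γ : SL(2, ℤ), f ∣[k] γ = f) :
    IsModular k f :=
  ⟨{ toFun := f
     slash_action_eq' := fun _ ⟨γ, hγ⟩ => hγ ▸ h γ
     holo' := hf.mdiff
     bdd_at_cusps' := fun {c} hc => by
      rw [Subgroup.IsArithmetic.isCusp_iff_isCusp_SL2Z] at hc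
      rw [OnePoint.isBoundedAt_iff_forall_SL2Z hc]
      intro γ _
      exact (h γ).symm ▸ hf.bounded }, rfl⟩

lemma slash (hf : IsModular k f) (γ : SL(2, ℤ)) : f ∣[k] γ = f := by
  obtain ⟨f, rfl⟩ := hf
  exact SlashInvariantFormClass.slash_action_eq f _ ⟨γ, rfl⟩

lemma zero (k : ℤ) : IsModular k 0 := ⟨0, rfl⟩

lemma const (c : ℂ) : IsModular 0 (fun _ => c) := ⟨ModularForm.const c, rfl⟩

lemma sub (hf : IsModular k f) (hg : IsModular k g) : IsModular k (f - g) := by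
  obtain ⟨f, rfl⟩ := hf
  obtain ⟨g, rfl⟩ := hg
  exact ⟨f - g, rfl⟩

lemma smul (hf : IsModular k f) (c : ℂ) : IsModular k (c • f) := by
  obtain ⟨f, rfl⟩ := hf
  exact ⟨c • f, rfl⟩

lemma mul (hf : IsModular k f) (hg : IsModular l g) : IsModular (k + l) (f * g) := by
  obtain ⟨f, rfl⟩ := hf
  obtain ⟨g, rfl⟩ := hg
  exact ⟨f.mul g, rfl⟩

lemma cast (hf : IsModular k f) (h : k = l) : IsModular l f := h ▸ hf

lemma pow (hf : IsModular k f) (n : ℕ) : IsModular (n * k) (f ^ n) := by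
  obtain ⟨f, rfl⟩ := hf
  exact ⟨f.pow n, by simp⟩

lemma eq_zero_of_coeff {n : ℕ} (hf : IsModular k f) (hn : k < 12 * n)
    (h : ∀ i < n, (qExpansion 1 f).coeff i = 0) : f = 0 := by
  rcases lt_or_ge k 0 with hk | hk
  · obtain ⟨f, rfl⟩ := hf
    exact ModularFormClass.levelOne_neg_weight_eq_zero hk f
  obtain ⟨f, rfl⟩ := hf
  have : f = 0 := by
    apply ModularForm.sturm_bound_levelOne
    refine lt_of_lt_of_le ?_ (PowerSeries.nat_le_order _ n h)
    exact_mod_cast (by omega : k.toNat / 12 < n)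
  rw [this]; rfl

lemma serreDerivative (hf : IsModular k f) :
    IsModular (k + 2) (Derivative.serreDerivative k f) := by
  refine of_slash ?_ fun γ => Derivative.serreDerivative_slash_invariant hf.holo.mdiff (hf.slash γ)
  have : Derivative.serreDerivative k f = Derivative.normalizedDerivOfComplex f -
      ((k : ℂ) * 12⁻¹) • (EisensteinSeries.E2 * f) := by
    ext z
    simp [mul_assoc]
  rw [this]
  exact hf.holo.deriv.sub ((isHolomorphicAtCusp_E2.mul hf.holo).smul _)

lemma qExpansion_serreDerivative (hf : IsModular k f) :
    qExpansion 1 (Derivative.serreDerivative k f) =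
      qExpansion 1 (Derivative.normalizedDerivOfComplex f) -
      ((k : ℂ) * 12⁻¹) • (qExpansion 1 EisensteinSeries.E2 * qExpansion 1 f) := by
  have : Derivative.serreDerivative k f = Derivative.normalizedDerivOfComplex f -
      ((k : ℂ) * 12⁻¹) • (EisensteinSeries.E2 * f) := by
    ext z
    simp [mul_assoc]
  rw [this, hf.holo.deriv.qExpansion_sub ((isHolomorphicAtCusp_E2.mul hf.holo).smul _),
    (isHolomorphicAtCusp_E2.mul hf.holo).qExpansion_smul,
    isHolomorphicAtCusp_E2.qExpansion_mul hf.holo]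

end IsModular

/-- Below weight 12 the Sturm bound asks only for the constant term. Each of Ramanujan's identities
is thereby reduced to modularity of both sides and one coefficient. -/
lemma eq_of_isModular_of_coeff_zero {k : ℤ} (hk : k < 12) {f g : ℍ → ℂ} (hf : IsModular k f)
    (hg : IsModular k g) (h : (qExpansion 1 f).coeff 0 = (qExpansion 1 g).coeff 0) : f = g := by
  refine sub_eq_zero.mp ((hf.sub hg).eq_zero_of_coeff (n := 1) (by simpa using hk) fun i hi => ?_)
  obtain rfl : i = 0 := by omega
  rw [hf.holo.qExpansion_sub hg.holo, map_sub, h, sub_self]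

lemma isModular_E₄ : IsModular 4 ModularForm.E₄ := ⟨_, rfl⟩

lemma isModular_E₆ : IsModular 6 ModularForm.E₆ := ⟨_, rfl⟩

lemma isModular_discriminant : IsModular 12 ModularForm.discriminant :=
  ⟨(CuspForm.discriminant : ModularForm 𝒮ℒ 12), rfl⟩

lemma coeff_zero_qExpansion_E₄ : (qExpansion 1 ModularForm.E₄).coeff 0 = 1 :=
  EisensteinSeries.E_qExpansion_coeff_zero _ ⟨2, rfl⟩

lemma coeff_zero_qExpansion_E₆ : (qExpansion 1 ModularForm.E₆).coeff 0 = 1 :=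
  EisensteinSeries.E_qExpansion_coeff_zero _ ⟨3, rfl⟩

lemma coeff_qExpansion_E₄ (n : ℕ) : (qExpansion 1 ModularForm.E₄).coeff n =
    if n = 0 then 1 else 240 * (ArithmeticFunction.sigma 3 n : ℂ) := by
  rw [EisensteinSeries.E_qExpansion_coeff _ ⟨2, rfl⟩]
  norm_num [bernoulli_eq_bernoulli'_of_ne_one, bernoulli'_four]

lemma coeff_qExpansion_E₆ (n : ℕ) : (qExpansion 1 ModularForm.E₆).coeff n =
    if n = 0 then 1 else -504 * (ArithmeticFunction.sigma 5 n : ℂ) := by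
  rw [EisensteinSeries.E_qExpansion_coeff _ ⟨3, rfl⟩]
  have : bernoulli 6 = 1 / 42 := by decide +kernel
  norm_num [this]

lemma serreDerivative_E₄ :
    Derivative.serreDerivative 4 ModularForm.E₄ = (-3⁻¹ : ℂ) • ModularForm.E₆ := by
  have h := isModular_E₄.serreDerivative
  have h' := isModular_E₄.qExpansion_serreDerivative
  push_cast at h h'
  refine eq_of_isModular_of_coeff_zero (k := 6) (by norm_num) h (isModular_E₆.smul _) ?_
  rw [h', isModular_E₆.holo.qExpansion_smul]
  simp [PowerSeries.coeff_mul, isModular_E₄.holo.coeff_qExpansion_deriv, coeff_zero_qExpansion_E₄,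
      coeff_zero_qExpansion_E₆, coeff_qExpansion_E2, -PowerSeries.coeff_zero_eq_constantCoeff]
  norm_num

lemma serreDerivative_E₆ :
    Derivative.serreDerivative 6 ModularForm.E₆ =
      (-2⁻¹ : ℂ) • (ModularForm.E₄ * ModularForm.E₄ : ℍ → ℂ) := by
  have h := isModular_E₆.serreDerivative
  have h' := isModular_E₆.qExpansion_serreDerivative
  push_cast at h h'
  refine eq_of_isModular_of_coeff_zero (k := 8) (by norm_num) h
    ((isModular_E₄.mul isModular_E₄).smul _) ?_
  rw [h', (isModular_E₄.mul isModular_E₄).holo.qExpansion_smul,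
      isModular_E₄.holo.qExpansion_mul isModular_E₄.holo]
  simp [PowerSeries.coeff_mul, isModular_E₆.holo.coeff_qExpansion_deriv, coeff_zero_qExpansion_E₄,
      coeff_zero_qExpansion_E₆, coeff_qExpansion_E2, -PowerSeries.coeff_zero_eq_constantCoeff]
  norm_num

open EisensteinSeries in
lemma hasDerivAt_D2 (γ : SL(2, ℤ)) (z : ℍ) :
    HasDerivAt (D2 γ ∘ ofComplex) (-(2 * Real.pi * I *
      (γ 1 0 : ℂ) ^ 2 / denom γ z ^ 2)) (z : ℂ) := by
  have h := (hasDerivAt_denom_zpow (γ : GL (Fin 2) ℝ) (-1) z).const_mul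
    (2 * Real.pi * I * (γ 1 0 : ℂ))
  have e : (D2 γ ∘ ofComplex) =ᶠ[nhds (z : ℂ)]
      fun w => 2 * Real.pi * I * (γ 1 0 : ℂ) * denom (γ : GL (Fin 2) ℝ) w ^ (-1 : ℤ) := by
    filter_upwards [isOpen_upperHalfPlaneSet.mem_nhds z.im_pos] with w hw
    simp [D2, ofComplex_apply_of_im_pos hw, div_eq_mul_inv]
  refine (h.congr_of_eventuallyEq e).congr_deriv ?_
  have : (-1 - 1 : ℤ) = -2 := rfl
  rw [this, zpow_neg]
  simp [zpow_ofNat, div_eq_mul_inv]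
  ring

-- The anomaly of `E₂` under `γ` is a multiple of `t = c/(cz + d)`. Its derivative is a multiple of
-- `t²`, and the factor `1/12` is the one for which the terms in `t` and `t²` cancel against those
-- of `E₂²`.
open EisensteinSeries Derivative in
lemma slash_deriv_E2 (γ : SL(2, ℤ)) :
    (normalizedDerivOfComplex E2 - (12⁻¹ : ℂ) • (E2 * E2)) ∣[(4 : ℤ)] γ =
      normalizedDerivOfComplex E2 - (12⁻¹ : ℂ) • (E2 * E2) := by
  have hD2 : MDiff (D2 γ) := fun z => mdifferentiableAt_iff.mpr (hasDerivAt_D2 γ z).differentiableAt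
  have hE := E2_slash_action γ
  have h1 := normalizedDerivOfComplex_SL_slash (k := 2) E2_mdifferentiable (γ := γ)
  rw [hE, normalizedDerivOfComplex_sub _ _ E2_mdifferentiable (hD2.const_smul _),
    normalizedDerivOfComplex_smul _ _ hD2] at h1
  rw [sub_eq_add_neg, SlashAction.add_slash, SlashAction.neg_slash, ModularForm.SL_smul_slash,
    show (4 : ℤ) = 2 + 2 from rfl, ModularForm.mul_slash_SL2, hE]
  ext z
  have h2 := congrFun h1 z
  have hd : denom γ z ≠ 0 := denom_ne_zero _ z
  simp only [Pi.add_apply, Pi.neg_apply, Pi.sub_apply, Pi.smul_apply, Pi.mul_apply, smul_eq_mul,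
    Int.reduceAdd] at h2 ⊢
  have h3 : normalizedDerivOfComplex (D2 γ) z = -((γ 1 0 : ℂ) / denom γ z) ^ 2 := by
    rw [normalizedDerivOfComplex, (hasDerivAt_D2 γ z).deriv]
    field_simp [Real.pi_ne_zero]
  rw [h3, riemannZeta_two] at h2
  rw [riemannZeta_two]
  simp only [D2] at h2 ⊢
  push_cast at h2
  have hpi : (Real.pi : ℂ) ≠ 0 := by exact_mod_cast Real.pi_ne_zero
  rw [mul_inv, inv_I, mul_div_assoc] at h2
  rw [mul_div_assoc]
  generalize (γ 1 0 : ℂ) / denom γ z = t at h2 ⊢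
  rw [show (normalizedDerivOfComplex E2 ∣[(4 : ℤ)] γ) z = normalizedDerivOfComplex E2 z -
      1 / (2 * ((Real.pi : ℂ) ^ 2 / 6)) * -t ^ 2 + 2 * ((2 * (Real.pi : ℂ))⁻¹ * -I) * t *
        (E2 z - 1 / (2 * ((Real.pi : ℂ) ^ 2 / 6)) * (2 * (Real.pi : ℂ) * I * t)) by rw [h2]; ring]
  field_simp
  ring_nf
  simp only [I_sq]
  ring

open EisensteinSeries Derivative in
lemma deriv_E2 :
    normalizedDerivOfComplex E2 - (12⁻¹ : ℂ) • (E2 * E2) = (-12⁻¹ : ℂ) • ModularForm.E₄ := by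
  have hE := isHolomorphicAtCusp_E2
  refine eq_of_isModular_of_coeff_zero (k := 4) (by norm_num)
    (.of_slash (hE.deriv.sub ((hE.mul hE).smul _)) slash_deriv_E2) (isModular_E₄.smul _) ?_
  rw [hE.deriv.qExpansion_sub ((hE.mul hE).smul _), (hE.mul hE).qExpansion_smul,
    hE.qExpansion_mul hE, isModular_E₄.holo.qExpansion_smul]
  simp [PowerSeries.coeff_mul, hE.coeff_qExpansion_deriv, coeff_zero_qExpansion_E₄,
    coeff_qExpansion_E2, -PowerSeries.coeff_zero_eq_constantCoeff]

open EisensteinSeries Derivative in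
lemma qExpansion_deriv_E2 : qExpansion 1 (normalizedDerivOfComplex E2) =
    (12⁻¹ : ℂ) • (qExpansion 1 E2 ^ 2 - qExpansion 1 ModularForm.E₄) := by
  have hE := isHolomorphicAtCusp_E2
  have h := congrArg (qExpansion 1) deriv_E2
  rw [hE.deriv.qExpansion_sub ((hE.mul hE).smul _), (hE.mul hE).qExpansion_smul,
    hE.qExpansion_mul hE, isModular_E₄.holo.qExpansion_smul] at h
  rw [sub_eq_iff_eq_add.mp h, pow_two]
  module

open EisensteinSeries Derivative in
lemma qExpansion_deriv_E₄ : qExpansion 1 (normalizedDerivOfComplex ModularForm.E₄) =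
    (3⁻¹ : ℂ) • (qExpansion 1 E2 * qExpansion 1 ModularForm.E₄ - qExpansion 1 ModularForm.E₆) := by
  have h := isModular_E₄.qExpansion_serreDerivative
  push_cast at h
  rw [serreDerivative_E₄, isModular_E₆.holo.qExpansion_smul] at h
  rw [← eq_sub_iff_add_eq.mp h]
  module

open EisensteinSeries Derivative in
lemma qExpansion_deriv_E₆ : qExpansion 1 (normalizedDerivOfComplex ModularForm.E₆) =
    (2⁻¹ : ℂ) • (qExpansion 1 E2 * qExpansion 1 ModularForm.E₆ -
      qExpansion 1 ModularForm.E₄ ^ 2) := by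
  have h := isModular_E₆.qExpansion_serreDerivative
  push_cast at h
  rw [serreDerivative_E₆, (isModular_E₄.mul isModular_E₄).holo.qExpansion_smul,
    isModular_E₄.holo.qExpansion_mul isModular_E₄.holo] at h
  rw [← eq_sub_iff_add_eq.mp h, pow_two]
  module

lemma qExpansion_discriminant : (1728 : ℂ) • qExpansion 1 ModularForm.discriminant =
    qExpansion 1 ModularForm.E₄ ^ 3 - qExpansion 1 ModularForm.E₆ ^ 2 := by
  have h4 := isModular_E₄.holo
  have h6 := isModular_E₆.holo
  have h : (1728 : ℂ) • ModularForm.discriminant =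
      (ModularForm.E₄ * (ModularForm.E₄ * ModularForm.E₄) - ModularForm.E₆ *
        ModularForm.E₆ : ℍ → ℂ) := by
    ext z
    simp [ModularForm.discriminant_eq_E₄_cube_sub_E₆_sq]
    ring
  rw [← isModular_discriminant.holo.qExpansion_smul, h, (h4.mul (h4.mul h4)).qExpansion_sub
    (h6.mul h6), h4.qExpansion_mul (h4.mul h4), h4.qExpansion_mul h4, h6.qExpansion_mul h6]
  ring

end QSeries

noncomputable section

/-! ### The derivation 12 q d/dq on power series -/

section EulerDerivation

open PowerSeries

/-- The derivation `12 q d/dq`. -/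
def eulerDerivation (F : Type*) [Field F] : Derivation F (PowerSeries F) (PowerSeries F) :=
  (12 * X : PowerSeries F) • PowerSeries.derivative F

variable {F : Type*} [Field F]

lemma coeff_eulerDerivation (f : PowerSeries F) (n : ℕ) :
    (eulerDerivation F f).coeff n = 12 * n * f.coeff n := by
  have : eulerDerivation F f = X * (C (12 : F) * PowerSeries.derivative F f) := by
    simp only [eulerDerivation, Derivation.smul_apply, smul_eq_mul, map_ofNat]
    ring
  rw [this]
  cases n with
  | zero => simp
  | succ n =>
    rw [coeff_succ_X_mul, coeff_C_mul, PowerSeries.coeff_derivative]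
    push_cast
    ring

lemma eulerDerivation_C (c : F) : eulerDerivation F (C c) = 0 := by
  ext n
  rw [coeff_eulerDerivation, coeff_C]
  split_ifs with h <;> simp [h]

lemma eulerDerivation_X : eulerDerivation F X = 12 * X := by
  simp [eulerDerivation]

lemma eulerDerivation_map {K : Type*} [Field K] (φ : F →+* K) (f : PowerSeries F) :
    eulerDerivation K (f.map φ) = (eulerDerivation F f).map φ := by
  ext n
  simp only [coeff_eulerDerivation, coeff_map, map_mul, map_ofNat, map_natCast]

lemma eulerDerivation_qExpansion {f : ℍ → ℂ} (hf : IsHolomorphicAtCusp f) :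
    eulerDerivation ℂ (qExpansion 1 f) =
      (12 : ℂ) • qExpansion 1 (Derivative.normalizedDerivOfComplex f) := by
  ext n
  rw [coeff_eulerDerivation, coeff_smul, hf.coeff_qExpansion_deriv, smul_eq_mul, mul_assoc]

end EulerDerivation

/-! ### Eisenstein series over ℚ, available over every field of characteristic zero -/

section RationalSeries

open PowerSeries ArithmeticFunction

/-- The `q`-expansion of `E₂`. -/
def seriesE₂ : PowerSeries ℚ := mk fun n => if n = 0 then 1 else -24 * sigma 1 n

/-- The `q`-expansion of `E₄`. -/
def seriesE₄ : PowerSeries ℚ := mk fun n => if n = 0 then 1 else 240 * sigma 3 n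

/-- The `q`-expansion of `E₆`. -/
def seriesE₆ : PowerSeries ℚ := mk fun n => if n = 0 then 1 else -504 * sigma 5 n

/-- The `q`-expansion of `Δ`. -/
def seriesDelta : PowerSeries ℚ := C (1 / 1728) * (seriesE₄ ^ 3 - seriesE₆ ^ 2)

/-- The normalized square root of `Δ / q`. -/
def seriesSqrtDelta : PowerSeries ℚ := normSqrt (mk fun n => seriesDelta.coeff (n + 1))

lemma map_seriesE₂ : seriesE₂.map (algebraMap ℚ ℂ) = qExpansion 1 EisensteinSeries.E2 := by
  ext n
  rw [coeff_qExpansion_E2, coeff_map, seriesE₂, coeff_mk]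
  split_ifs <;> simp

lemma map_seriesE₄ : seriesE₄.map (algebraMap ℚ ℂ) = qExpansion 1 ModularForm.E₄ := by
  ext n
  rw [coeff_qExpansion_E₄, coeff_map, seriesE₄, coeff_mk]
  split_ifs <;> simp

lemma map_seriesE₆ : seriesE₆.map (algebraMap ℚ ℂ) = qExpansion 1 ModularForm.E₆ := by
  ext n
  rw [coeff_qExpansion_E₆, coeff_map, seriesE₆, coeff_mk]
  split_ifs <;> simp

lemma map_seriesDelta :
    seriesDelta.map (algebraMap ℚ ℂ) = qExpansion 1 ModularForm.discriminant := by
  rw [seriesDelta, map_mul, map_sub, map_pow, map_pow, map_seriesE₄, map_seriesE₆,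
    ← qExpansion_discriminant, map_C, ← smul_eq_C_mul, smul_smul]
  norm_num

lemma map_algebraMap_injective : Function.Injective (PowerSeries.map (algebraMap ℚ ℂ)) :=
  PowerSeries.map_injective _ (algebraMap ℚ ℂ).injective

lemma eulerDerivation_seriesE₂ :
    eulerDerivation ℚ seriesE₂ = seriesE₂ ^ 2 - seriesE₄ := by
  apply map_algebraMap_injective
  rw [← eulerDerivation_map, map_sub, map_pow, map_seriesE₂, map_seriesE₄,
    eulerDerivation_qExpansion isHolomorphicAtCusp_E2, qExpansion_deriv_E2, smul_smul]
  norm_num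

lemma eulerDerivation_seriesE₄ :
    eulerDerivation ℚ seriesE₄ = 4 * (seriesE₂ * seriesE₄ - seriesE₆) := by
  apply map_algebraMap_injective
  rw [← eulerDerivation_map, map_mul, map_sub, map_mul, map_seriesE₂, map_seriesE₄, map_seriesE₆,
    eulerDerivation_qExpansion isModular_E₄.holo, qExpansion_deriv_E₄, smul_smul, smul_eq_C_mul,
    map_ofNat, ← map_ofNat C]
  norm_num

lemma eulerDerivation_seriesE₆ :
    eulerDerivation ℚ seriesE₆ = 6 * (seriesE₂ * seriesE₆ - seriesE₄ ^ 2) := by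
  apply map_algebraMap_injective
  rw [← eulerDerivation_map, map_mul, map_sub, map_mul, map_pow, map_seriesE₂, map_seriesE₄,
    map_seriesE₆, eulerDerivation_qExpansion isModular_E₆.holo, qExpansion_deriv_E₆, smul_smul,
    smul_eq_C_mul, map_ofNat, ← map_ofNat C]
  norm_num

lemma eulerDerivation_seriesDelta :
    eulerDerivation ℚ seriesDelta = 12 * seriesE₂ * seriesDelta := by
  simp only [seriesDelta, Derivation.leibniz, eulerDerivation_C, map_sub, Derivation.leibniz_pow,
    eulerDerivation_seriesE₄, eulerDerivation_seriesE₆, smul_eq_mul, nsmul_eq_mul]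
  push_cast
  ring

lemma coeff_seriesE₂_zero : seriesE₂.coeff 0 = 1 := by simp [seriesE₂]
lemma coeff_seriesE₄_zero : seriesE₄.coeff 0 = 1 := by simp [seriesE₄]
lemma coeff_seriesE₆_zero : seriesE₆.coeff 0 = 1 := by simp [seriesE₆]
lemma coeff_seriesE₂_one : seriesE₂.coeff 1 = -24 := by simp [seriesE₂]
lemma coeff_seriesE₄_one : seriesE₄.coeff 1 = 240 := by simp [seriesE₄]
lemma coeff_seriesE₆_one : seriesE₆.coeff 1 = -504 := by simp [seriesE₆]

lemma coeff_seriesDelta_zero : seriesDelta.coeff 0 = 0 := by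
  have h4 := coeff_seriesE₄_zero
  have h6 := coeff_seriesE₆_zero
  rw [coeff_zero_eq_constantCoeff_apply] at *
  simp [seriesDelta, h4, h6]

lemma coeff_seriesDelta_one : seriesDelta.coeff 1 = 1 := by
  have h : ((seriesDelta.coeff 1 : ℚ) : ℂ) = 1 := by
    have := congrArg (PowerSeries.coeff 1) map_seriesDelta
    rw [coeff_map, ModularForm.discriminant_qExpansion_coeff_one] at this
    exact this
  exact_mod_cast h

lemma coeff_seriesSqrtDelta_zero : seriesSqrtDelta.coeff 0 = 1 := coeff_zero_normSqrt _

lemma seriesDelta_eq : seriesDelta = X * seriesSqrtDelta ^ 2 := by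
  rw [seriesSqrtDelta, normSqrt_sq _ (by simpa using coeff_seriesDelta_one)]
  ext n
  cases n with
  | zero => simpa using coeff_seriesDelta_zero
  | succ n => simp [coeff_succ_X_mul]

lemma constantCoeff_ne_zero_of_coeff {F : Type*} [Field F] {f : PowerSeries F}
    (h : f.coeff 0 = 1) : constantCoeff f ≠ 0 := by
  rw [← coeff_zero_eq_constantCoeff_apply, h]
  exact one_ne_zero

lemma ne_zero_of_coeff_zero {F : Type*} [Field F] {f : PowerSeries F}
    (h : f.coeff 0 = 1) : f ≠ 0 := by
  rintro rfl
  simp at h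

lemma mul_inv_of_coeff_zero {F : Type*} [Field F] {f : PowerSeries F} (h : f.coeff 0 = 1) :
    f * f⁻¹ = 1 := PowerSeries.mul_inv_cancel _ (constantCoeff_ne_zero_of_coeff h)

/-- The quotient `E₆ / E₄`. -/
def seriesT : PowerSeries ℚ := seriesE₆ * seriesE₄⁻¹

lemma seriesE₄_mul_seriesT : seriesE₄ * seriesT = seriesE₆ := by
  rw [seriesT, mul_left_comm, mul_inv_of_coeff_zero coeff_seriesE₄_zero, mul_one]

lemma eulerDerivation_inv {F : Type*} [Field F] {f a : PowerSeries F} (h : f.coeff 0 = 1)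
    (hf : eulerDerivation F f = a * f) : eulerDerivation F f⁻¹ = -a * f⁻¹ := by
  have h1 := congrArg (eulerDerivation F) (mul_inv_of_coeff_zero h)
  rw [Derivation.leibniz, hf, Derivation.map_one_eq_zero, smul_eq_mul, smul_eq_mul] at h1
  apply mul_left_cancel₀ (ne_zero_of_coeff_zero h)
  linear_combination h1

/-- The relations for `U` and `Z` come from differentiating `Δ = q S²` and `E₄ = N²`, where `S` and
`N` are the normalized square roots, then cancelling `2qS` or `2N` and inverting. -/
lemma isRamanujan_rat : IsRamanujan (eulerDerivation ℚ) seriesE₂ seriesE₄ seriesT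
    seriesSqrtDelta⁻¹ (normSqrt seriesE₄)⁻¹ := by
  have hT := seriesE₄_mul_seriesT
  have h4 := ne_zero_of_coeff_zero coeff_seriesE₄_zero
  have dQ : eulerDerivation ℚ seriesE₄ = 4 * seriesE₄ * (seriesE₂ - seriesT) := by
    rw [eulerDerivation_seriesE₄, ← hT]
    ring
  refine ⟨eulerDerivation_seriesE₂, dQ, ?_, ?_, ?_⟩
  · have h := eulerDerivation_seriesE₆
    rw [← hT, Derivation.leibniz, dQ, smul_eq_mul, smul_eq_mul] at h
    apply mul_left_cancel₀ h4
    linear_combination h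
  · have hS := ne_zero_of_coeff_zero coeff_seriesSqrtDelta_zero
    have h := eulerDerivation_seriesDelta
    rw [seriesDelta_eq, Derivation.leibniz, Derivation.leibniz_pow, eulerDerivation_X] at h
    simp only [smul_eq_mul, nsmul_eq_mul] at h
    rw [eulerDerivation_inv coeff_seriesSqrtDelta_zero (a := 6 * (seriesE₂ - 1))]
    · ring
    · have h2 : (2 * (X * seriesSqrtDelta) : PowerSeries ℚ) ≠ 0 :=
        mul_ne_zero (by rw [← map_ofNat C 2]; simp) (mul_ne_zero X_ne_zero hS)
      apply mul_left_cancel₀ h2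
      linear_combination h
  · have hN := ne_zero_of_coeff_zero (coeff_zero_normSqrt seriesE₄)
    have h : eulerDerivation ℚ (normSqrt seriesE₄ ^ 2) =
        4 * normSqrt seriesE₄ ^ 2 * (seriesE₂ - seriesT) := by
      rw [normSqrt_sq _ coeff_seriesE₄_zero, dQ]
    rw [Derivation.leibniz_pow] at h
    simp only [smul_eq_mul, nsmul_eq_mul] at h
    rw [eulerDerivation_inv (coeff_zero_normSqrt _) (a := 2 * (seriesE₂ - seriesT))]
    · ring
    · have h2 : (2 * normSqrt seriesE₄ : PowerSeries ℚ) ≠ 0 :=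
        mul_ne_zero (by rw [← map_ofNat C 2]; simp) hN
      apply mul_left_cancel₀ h2
      linear_combination h

end RationalSeries

/-! ### The Frobenius solution with a parameter, and its three-term relation -/

section HypergeometricSeries

open PowerSeries

lemma coeff_mul_eq_sum_fin {R : Type*} [CommRing R] (f g : PowerSeries R) (n : ℕ) :
    (f * g).coeff n = f.coeff 0 * g.coeff n + ∑ i : Fin n, f.coeff (n - i) * g.coeff i := by
  rw [mul_comm f g, coeff_mul, Finset.Nat.sum_antidiagonal_eq_sum_range_succ
    (fun i j => g.coeff i * f.coeff j), Finset.sum_range_succ, Finset.sum_range, Nat.sub_self,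
    add_comm, mul_comm]
  congr 1
  exact Finset.sum_congr rfl fun i _ => mul_comm _ _

lemma coeff_zero_mul' {R : Type*} [CommRing R] (f g : PowerSeries R) :
    (f * g).coeff 0 = f.coeff 0 * g.coeff 0 := by
  simp [coeff_mul_eq_sum_fin]

lemma coeff_one_mul' {R : Type*} [CommRing R] (f g : PowerSeries R) :
    (f * g).coeff 1 = f.coeff 0 * g.coeff 1 + f.coeff 1 * g.coeff 0 := by
  simp [coeff_mul_eq_sum_fin]

variable {F : Type*} [Field F]

/-- The coefficients of the solution `1 + O(q)` of the equation with potential `w`. -/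
def frobeniusCoeff (w : PowerSeries F) (κ : F) : ℕ → F
  | 0 => 1
  | n + 1 => (∑ i : Fin (n + 1), w.coeff (n + 1 - i) * frobeniusCoeff w κ i) /
      (144 * (n + 1) * (n + 1 + κ))

variable [CharZero F]

variable (F) in
/-- A power series with rational coefficients, seen over `F`. -/
def overField (f : PowerSeries ℚ) : PowerSeries F := f.map (algebraMap ℚ F)

/-- The potential `36 κ² E₄ - 12 E₄ + 12 (E₆ / E₄)²`. -/
def potential (κ : F) : PowerSeries F :=
  C (6 * κ) ^ 2 * overField F seriesE₄ - 12 * overField F seriesE₄ + 12 * overField F seriesT ^ 2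

/-- `q ^ (-κ / 2) φ_κ`, for any `κ` in a field of characteristic `0` that is not a negative
integer. -/
def phiTail (κ : F) : PowerSeries F := mk (frobeniusCoeff (potential κ) κ)

/-- The equation satisfied by `q ^ (-s / 12)` times a solution with parameter `m`, over `F`. -/
def IsSolution (s m : F) (y : PowerSeries F) : Prop :=
  IsKZSolution (eulerDerivation F) (overField F seriesE₄) (overField F seriesT) (C s) (C m) y

lemma isRamanujan_overField : IsRamanujan (eulerDerivation F) (overField F seriesE₂)
    (overField F seriesE₄) (overField F seriesT) (overField F seriesSqrtDelta⁻¹)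
    (overField F (normSqrt seriesE₄)⁻¹) := by
  have h := isRamanujan_rat
  constructor <;> simp only [overField, eulerDerivation_map]
  · rw [h.dP, map_sub, map_pow]
  · rw [h.dQ, map_mul, map_mul, map_sub, map_ofNat]
  · rw [h.dT, map_add, map_sub, map_mul, map_mul, map_mul, map_mul, map_pow, map_ofNat, map_ofNat,
      map_ofNat]
  · rw [h.dU, map_mul, map_mul, map_sub, map_neg, map_one, map_ofNat]
  · rw [h.dZ, map_mul, map_mul, map_sub, map_neg, map_ofNat]

lemma coeff_overField (f : PowerSeries ℚ) (n : ℕ) :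
    (overField F f).coeff n = (f.coeff n : F) := by
  simp [overField]

lemma coeff_seriesT_zero : seriesT.coeff 0 = 1 := by
  have := congrArg (coeff 0) seriesE₄_mul_seriesT
  rwa [coeff_mul_eq_sum_fin, coeff_seriesE₄_zero, coeff_seriesE₆_zero, Fin.sum_univ_zero, one_mul,
    add_zero] at this

lemma coeff_seriesT_one : seriesT.coeff 1 = -744 := by
  have := congrArg (coeff 1) seriesE₄_mul_seriesT
  rw [coeff_mul_eq_sum_fin, coeff_seriesE₄_zero, coeff_seriesE₆_one, Fin.sum_univ_one] at this
  simp only [Fin.val_zero, Nat.sub_zero, coeff_seriesE₄_one, coeff_seriesT_zero] at this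
  linarith

lemma coeff_potential_zero (κ : F) : (potential κ).coeff 0 = 36 * κ ^ 2 := by
  simp only [potential, pow_two, map_add, map_sub, mul_assoc, coeff_zero_mul', coeff_overField,
    coeff_seriesE₄_zero, coeff_seriesT_zero, coeff_C, ← map_ofNat C]
  simp
  ring

lemma coeff_potential_one (κ : F) : (potential κ).coeff 1 = 144 * (60 * κ ^ 2 - 144) := by
  simp only [potential, pow_two, map_add, map_sub, mul_assoc, coeff_zero_mul', coeff_one_mul',
      coeff_overField,
    coeff_seriesT_zero, coeff_C, ← map_ofNat C, coeff_seriesE₄_one,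
    coeff_seriesT_one]
  simp [coeff_seriesE₄_zero, -coeff_zero_eq_constantCoeff]
  ring

lemma coeff_phiTail_zero (κ : F) : (phiTail κ).coeff 0 = 1 := by
  simp [phiTail, frobeniusCoeff]

lemma coeff_phiTail_succ (κ : F) (n : ℕ) : (phiTail κ).coeff (n + 1) =
    (∑ i : Fin (n + 1), (potential κ).coeff (n + 1 - i) * (phiTail κ).coeff i) /
      (144 * (n + 1) * (n + 1 + κ)) := by
  simp only [phiTail, coeff_mk]
  rw [frobeniusCoeff]

/-- Comparison of coefficients of `q^n`: the left side contributes `(12n + 6κ)²`, the constant term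
of the potential is `36κ²`, and the difference is `144n(n + κ)`. -/
lemma isSolution_iff (κ : F) (y : PowerSeries F) : IsSolution (6 * κ) (6 * κ) y ↔
    ∀ n, 144 * n * (n + κ) * y.coeff n = ∑ i : Fin n, (potential κ).coeff (n - i) * y.coeff i := by
  rw [IsSolution, IsKZSolution, PowerSeries.ext_iff]
  refine forall_congr' fun n => ?_
  have e : (C (6 * κ) ^ 2 * overField F seriesE₄ - 12 * overField F seriesE₄ +
    12 * overField F seriesT ^ 2) = potential κ := rfl
  have e2 : 2 * C (6 * κ) * eulerDerivation F y = C (12 * κ) * eulerDerivation F y := by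
    rw [← map_ofNat C 2, ← map_mul]
    congr 2
    ring
  rw [e, e2, coeff_mul_eq_sum_fin, coeff_potential_zero, ← map_pow]
  simp only [map_add, coeff_C_mul, coeff_eulerDerivation]
  constructor <;> intro h <;> linear_combination h

lemma isSolution_phiTail {κ : F} (hκ : ∀ n : ℕ, (n : F) + 1 + κ ≠ 0) :
    IsSolution (6 * κ) (6 * κ) (phiTail κ) := by
  rw [isSolution_iff]
  intro n
  cases n with
  | zero => simp
  | succ n =>
    rw [coeff_phiTail_succ]
    have h1 := hκ n
    have h2 : (n : F) + 1 ≠ 0 := Nat.cast_add_one_ne_zero n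
    push_cast
    field_simp

lemma IsSolution.eq_C_mul {κ : F} (hκ : ∀ n : ℕ, (n : F) + 1 + κ ≠ 0) {y : PowerSeries F}
    (hy : IsSolution (6 * κ) (6 * κ) y) : y = C (y.coeff 0) * phiTail κ := by
  rw [isSolution_iff] at hy
  ext n
  rw [coeff_C_mul]
  induction n using Nat.strong_induction_on with
  | _ n ih =>
  cases n with
  | zero => rw [coeff_phiTail_zero, mul_one]
  | succ n =>
    have h1 := hκ n
    have h2 : (n : F) + 1 ≠ 0 := Nat.cast_add_one_ne_zero n
    have h := hy (n + 1)
    rw [Finset.sum_congr rfl fun i _ => by rw [ih i i.2, mul_left_comm], ← Finset.mul_sum] at h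
    rw [coeff_phiTail_succ, ← mul_div_assoc, ← h]
    push_cast
    field_simp

/-- `D(Xy) = X(D + 12)y`, so removing a factor `q` raises the exponent parameter by 12. -/
lemma isSolution_X_mul {s m : F} {y : PowerSeries F} (h : IsSolution s m (X * y)) :
    IsSolution (s + 12) m y := by
  unfold IsSolution IsKZSolution at *
  have n12 : eulerDerivation F 12 = 0 := by rw [← map_ofNat C 12, eulerDerivation_C]
  simp only [Derivation.leibniz, eulerDerivation_X, smul_eq_mul, map_add, n12] at h
  apply mul_left_cancel₀ (X_ne_zero (R := F))
  rw [map_add, map_ofNat]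
  linear_combination h

lemma coeff_overField_zero {f : PowerSeries ℚ} (h : f.coeff 0 = 1) :
    (overField F f).coeff 0 = 1 := by
  rw [coeff_overField, h, Rat.cast_one]

omit [CharZero F] in
lemma coeff_inv_zero {f : PowerSeries F} (h : f.coeff 0 = 1) : f⁻¹.coeff 0 = 1 := by
  have := congrArg (coeff 0) (mul_inv_of_coeff_zero h)
  rwa [coeff_zero_mul', h, one_mul, coeff_zero_one] at this

lemma coeff_inv_seriesSqrtDelta_one : seriesSqrtDelta⁻¹.coeff 1 = 12 := by
  have h := congrArg (coeff 1) isRamanujan_rat.dU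
  rw [← map_ofNat C 6, ← map_neg, mul_assoc, coeff_C_mul, coeff_eulerDerivation,
    coeff_one_mul'] at h
  simp only [map_sub, coeff_seriesE₂_zero, coeff_seriesE₂_one, coeff_one,
      coeff_inv_zero coeff_seriesSqrtDelta_zero] at h
  norm_num at h
  linarith

variable (F) in
/-- The `q`-expansion of `E₆ (Δ / q) ^ (-1/2)`. -/
def shiftFactor : PowerSeries F :=
  overField F seriesE₄ * overField F seriesT * overField F seriesSqrtDelta⁻¹

lemma coeff_shiftFactor_zero : (shiftFactor F).coeff 0 = 1 := by
  simp only [shiftFactor, coeff_zero_mul', coeff_overField, coeff_seriesE₄_zero,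
    coeff_seriesT_zero, coeff_inv_zero coeff_seriesSqrtDelta_zero]
  simp

lemma coeff_shiftFactor_one : (shiftFactor F).coeff 1 = -492 := by
  simp only [shiftFactor, coeff_zero_mul', coeff_one_mul', coeff_overField, coeff_seriesE₄_zero,
    coeff_seriesT_zero, coeff_inv_zero coeff_seriesSqrtDelta_zero,
    coeff_seriesE₄_one, coeff_seriesT_one, coeff_inv_seriesSqrtDelta_one]
  norm_num

lemma coeff_phiTail_one (κ : F) : (phiTail κ).coeff 1 = (60 * κ ^ 2 - 144) / (1 + κ) := by
  have h := coeff_phiTail_succ κ 0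
  rw [Fin.sum_univ_one, Fin.val_zero, coeff_phiTail_zero] at h
  simp only [zero_add, Nat.sub_zero, coeff_potential_one, Nat.cast_zero, mul_one] at h
  rw [h, mul_div_mul_left _ _ (by norm_num)]

/-- The lowered series solves the equation for `κ`, hence is a multiple of `phiTail κ`. With `M =
6(κ + 1)`, its constant term is `M + 1 + (M - 1) = 2M`. -/
lemma lowering_phiTail {κ : F} (hκ : ∀ n : ℕ, (n : F) + 1 + κ ≠ 0) :
    lowering (eulerDerivation F) (overField F seriesE₂) (overField F seriesE₄)
      (overField F seriesT) (overField F seriesSqrtDelta⁻¹) (C (6 * (κ + 1))) (phiTail (κ + 1)) =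
    2 * C (6 * (κ + 1)) * phiTail κ := by
  have hκ' : ∀ n : ℕ, (n : F) + 1 + (κ + 1) ≠ 0 := fun n => by
    have := hκ (n + 1)
    push_cast at this
    convert this using 1
    ring
  have h := isKZSolution_lowering isRamanujan_overField (eulerDerivation_C _)
    (isSolution_phiTail hκ')
  have e : (C (6 * (κ + 1)) - 6 : PowerSeries F) = C (6 * κ) := by
    rw [← map_ofNat C 6, ← map_sub]
    congr 1
    ring
  rw [e] at h
  rw [IsSolution.eq_C_mul hκ h]
  congr 1
  rw [← map_ofNat C 2, ← map_mul]
  congr 1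
  simp only [lowering, coeff_zero_mul', map_add, map_sub, coeff_eulerDerivation,
    coeff_overField_zero coeff_seriesE₂_zero, coeff_overField_zero coeff_seriesE₄_zero,
    coeff_overField_zero coeff_seriesT_zero, coeff_phiTail_zero, coeff_zero_C, coeff_zero_one,
    coeff_overField_zero (coeff_inv_zero coeff_seriesSqrtDelta_zero)]
  push_cast
  ring

/-- The three-term relation between the series `phiTail`. -/
theorem phiTail_sub {κ : F} (hκ : ∀ n : ℕ, (n : F) + 1 + κ ≠ 0) :
    phiTail κ - shiftFactor F * phiTail (κ + 1) =
      C (muStar (κ + 1)) * (X * phiTail (κ + 2)) := by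
  have hκ' : ∀ n : ℕ, (n : F) + 1 + (κ + 1) ≠ 0 := fun n => by
    have := hκ (n + 1)
    push_cast at this
    convert this using 1
    ring
  have hκ'' : ∀ n : ℕ, (n : F) + 1 + (κ + 2) ≠ 0 := fun n => by
    have := hκ (n + 2)
    push_cast at this
    convert this using 1
    ring
  have e : (C (6 * (κ + 1)) - 6 : PowerSeries F) = C (6 * κ) := by
    rw [← map_ofNat C 6, ← map_sub]
    congr 1
    ring
  have e' : (C (6 * (κ + 1)) + 6 : PowerSeries F) = C (6 * (κ + 2)) := by
    rw [← map_ofNat C 6, ← map_add]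
    congr 1
    ring
  have h := isKZSolution_sub isRamanujan_overField (M := C (6 * (κ + 1))) (g := phiTail κ)
    (by rw [e]; exact isSolution_phiTail hκ) (isSolution_phiTail hκ') (lowering_phiTail hκ)
  rw [e, e'] at h
  set χ := phiTail κ - shiftFactor F * phiTail (κ + 1) with hχ
  -- Both terms have constant coefficient 1, so `χ` is divisible by `q`.
  have h0 : χ.coeff 0 = 0 := by
    rw [hχ, map_sub, coeff_zero_mul']
    simp only [coeff_phiTail_zero, coeff_shiftFactor_zero]
    ring
  have hX : χ = X * mk fun n => χ.coeff (n + 1) := by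
    ext n
    cases n with
    | zero => rw [h0, coeff_zero_X_mul]
    | succ n => rw [coeff_succ_X_mul, coeff_mk]
  have h1 : IsSolution (6 * κ) (6 * (κ + 2)) χ := h
  rw [hX] at h1
  -- Dividing by `q` moves the exponent parameter from `6κ` to `6(κ + 2)`, where it agrees with the
  -- parameter of the potential, and uniqueness applies.
  have h2 := isSolution_X_mul h1
  rw [show 6 * κ + 12 = 6 * (κ + 2) by ring] at h2
  rw [hX, IsSolution.eq_C_mul hκ'' h2, coeff_mk, mul_left_comm]
  congr 2
  have d1 := hκ 0
  have d2 := hκ 1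
  -- The factor is the coefficient of `q` in `χ`, namely `(60κ² - 144)/(κ + 1) + 492 - (60(κ + 1)² -
  -- 144)/(κ + 2)`, which equals `μ*_{κ+1}`.
  rw [hχ, map_sub, zero_add, coeff_one_mul']
  simp only [coeff_phiTail_zero, coeff_shiftFactor_zero, coeff_shiftFactor_one, coeff_phiTail_one,
    muStar]
  push_cast at d1 d2
  have d3 : 1 + κ ≠ 0 := by simpa using d1
  have d4 : 1 + (κ + 1) ≠ 0 := by convert d2 using 1; ring
  have d5 : κ + 1 ≠ 0 := by rwa [add_comm]
  have d6 : κ + 1 + 1 ≠ 0 := by rwa [add_comm]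
  field_simp
  ring

lemma phiTail_zero : phiTail (0 : F) = overField F (seriesE₂ * (normSqrt seriesE₄)⁻¹) := by
  have h := isKZSolution_zero (isRamanujan_overField (F := F))
  have e : (0 : PowerSeries F) = C (6 * 0) := by simp
  rw [e] at h
  have h2 := IsSolution.eq_C_mul (fun n => by simpa using Nat.cast_add_one_ne_zero n) h
  rw [coeff_zero_mul', coeff_overField_zero coeff_seriesE₂_zero,
    coeff_overField_zero (coeff_inv_zero (coeff_zero_normSqrt _)), mul_one,
    map_one, one_mul] at h2
  rw [← h2, overField, overField, overField, map_mul]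

lemma phiTail_one : C 1008 * (X * phiTail (1 : F)) =
    overField F ((seriesE₄ ^ 2 - seriesE₆ * seriesE₂) * seriesSqrtDelta⁻¹ *
      (normSqrt seriesE₄)⁻¹) := by
  have h := isKZSolution_one (isRamanujan_overField (F := F))
  have e : (6 : PowerSeries F) = C (6 * 1) := by rw [mul_one, map_ofNat]
  have e' : (-6 : PowerSeries F) = C (-6) := by rw [map_neg, map_ofNat]
  rw [e', e] at h
  set χ := overField F seriesE₄ * (overField F seriesE₄ - overField F seriesT *
      overField F seriesE₂)
    * overField F seriesSqrtDelta⁻¹ * overField F (normSqrt seriesE₄)⁻¹ with hχ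
  have h0 : χ.coeff 0 = 0 := by
    simp only [hχ, coeff_zero_mul', coeff_overField_zero coeff_seriesE₂_zero,
      coeff_overField_zero coeff_seriesE₄_zero,
    coeff_overField_zero coeff_seriesT_zero, map_sub]
    ring
  -- The factors `U` and `Z` have constant term 1, and `E₄² - E₆E₂ = (480 + 504 + 24)q + O(q²)`.
  have h1 : χ.coeff 1 = 1008 := by
    simp only [hχ, coeff_zero_mul', coeff_one_mul', coeff_overField, coeff_seriesE₂_zero,
      coeff_seriesE₄_zero, coeff_seriesE₂_one, coeff_seriesT_one, coeff_seriesE₄_one,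
    coeff_seriesT_zero, map_sub, coeff_inv_zero coeff_seriesSqrtDelta_zero,
      coeff_inv_zero (coeff_zero_normSqrt _)]
    norm_num
  have hX : χ = X * mk fun n => χ.coeff (n + 1) := by
    ext n
    cases n with
    | zero => rw [h0, coeff_zero_X_mul]
    | succ n => rw [coeff_succ_X_mul, coeff_mk]
  have h2 : IsSolution (-6) (6 * 1) χ := h
  rw [hX] at h2
  have h3 := isSolution_X_mul h2
  rw [show (-6 + 12 : F) = 6 * 1 by ring] at h3
  have h4 := IsSolution.eq_C_mul
    (fun n => by simpa using Nat.cast_add_one_ne_zero (R := F) (n + 1)) h3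
  rw [coeff_mk, zero_add, h1] at h4
  rw [mul_left_comm, ← h4, ← hX, hχ, ← seriesE₄_mul_seriesT]
  simp only [overField, map_mul, map_sub, map_pow]
  ring

/-- The Frobenius recursion commutes with field homomorphisms. This lets the shift `k ↦ k + 1` act
on the generic solution through its parameter alone. -/
lemma map_phiTail {K : Type*} [Field K] [CharZero K] (σ : F →+* K) (κ : F) :
    (phiTail κ).map σ = phiTail (σ κ) := by
  have hf (f : PowerSeries ℚ) : (overField F f).map σ = overField K f := by
    ext n
    simp [coeff_overField]
  have hw : (potential κ).map σ = potential (σ κ) := by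
    simp only [potential, map_add, map_sub, map_mul, map_pow, map_C, map_ofNat, hf]
  ext n
  rw [coeff_map]
  induction n using Nat.strong_induction_on with
  | _ n ih =>
  cases n with
  | zero => rw [coeff_phiTail_zero, coeff_phiTail_zero, map_one]
  | succ n =>
    rw [coeff_phiTail_succ, coeff_phiTail_succ, map_div₀, map_sum, ← hw]
    simp only [map_mul, coeff_map, map_add, map_natCast, map_one, map_ofNat]
    congr 1
    exact Finset.sum_congr rfl fun i _ => by rw [ih i i.2]

end HypergeometricSeries
end

noncomputable section

/-! ### The extremal forms: construction, dimension count, uniqueness -/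

section ExtremalForms

open PowerSeries

/-- Dividing by `Δ`, whose expansion is `q` times a unit, lowers the weight by 12 and the order by
1. After `k` steps a form of weight 2 remains, and there is none but zero. -/
lemma IsModular.eq_zero_of_X_pow_dvd {k : ℕ} {f : ℍ → ℂ} (hf : IsModular (12 * k + 2) f)
    (h : (X : PowerSeries ℂ) ^ k ∣ qExpansion 1 f) : f = 0 := by
  induction k generalizing f with
  | zero =>
    obtain ⟨g, rfl⟩ := hf
    have : g = 0 := rank_zero_iff_forall_zero.mp (by
      have := ModularForm.dimension_level_one 2 even_two
      simpa [Nat.ModEq] using this) g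
    rw [this]; rfl
  | succ k ih =>
    obtain ⟨g, rfl⟩ := hf
    have h0 : (qExpansion 1 g).coeff 0 = 0 := X_pow_dvd_iff.mp h 0 (Nat.succ_pos k)
    have hq := ModularForm.qExpansion_eq_qExpansion_discriminant_mul g h0
    set g' := CuspForm.discriminantEquiv (ModularForm.toCuspForm g h0) with hg'
    have hu : IsUnit (seriesSqrtDelta.map (algebraMap ℚ ℂ) ^ 2) := by
      refine IsUnit.pow _ (PowerSeries.isUnit_iff_constantCoeff.mpr ?_)
      rw [← coeff_zero_eq_constantCoeff_apply, coeff_map, coeff_seriesSqrtDelta_zero]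
      simp
    rw [hq, ← map_seriesDelta, seriesDelta_eq, map_mul, map_X, pow_succ', mul_assoc,
      mul_dvd_mul_iff_left X_ne_zero, map_pow, hu.dvd_mul_left] at h
    have := ih (f := g') (IsModular.cast ⟨g', rfl⟩ (by push_cast; ring)) h
    ext z
    have h2 := ModularForm.discriminant_mul_discriminantEquiv_apply (ModularForm.toCuspForm g h0) z
    rw [← hg', this, Pi.zero_apply, mul_zero] at h2
    exact h2.symm

/-- The solution with initial values `a`, `b` of the recursion
`μ*_{k+1} f_{k+2} = Δ f_k - E₆ f_{k+1}`. -/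
def threeTerm (a b : ℍ → ℂ) : ℕ → ℍ → ℂ
  | 0 => a
  | 1 => b
  | k + 2 => (muStar ((k : ℂ) + 1))⁻¹ • (ModularForm.discriminant * threeTerm a b k -
      ModularForm.E₆ * threeTerm a b (k + 1))

lemma isModular_threeTerm {a b : ℍ → ℂ} {w : ℤ} (ha : IsModular w a) (hb : IsModular (w + 6) b)
    (k : ℕ) : IsModular (6 * k + w) (threeTerm a b k) := by
  induction k using Nat.twoStepInduction with
  | zero => exact ha.cast (by simp)
  | one => exact hb.cast (by push_cast; ring)
  | more k h1 h2 =>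
    rw [threeTerm]
    exact (((isModular_discriminant.mul h1).cast (by push_cast; ring)).sub
      ((isModular_E₆.mul h2).cast (by push_cast; ring))).smul _

lemma holo_threeTerm {a b : ℍ → ℂ} (ha : IsHolomorphicAtCusp a) (hb : IsHolomorphicAtCusp b)
    (k : ℕ) : IsHolomorphicAtCusp (threeTerm a b k) := by
  induction k using Nat.twoStepInduction with
  | zero => exact ha
  | one => exact hb
  | more k h1 h2 =>
    rw [threeTerm]
    exact ((isModular_discriminant.holo.mul h1).sub (isModular_E₆.holo.mul h2)).smul _

/-- The coefficient of `E₂` in the normalized extremal form of depth `1` and weight `6 k + 2`. -/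
def extremalB : ℕ → ℍ → ℂ := threeTerm 1 (-(1008⁻¹ : ℂ) • ModularForm.E₆)

/-- The modular part of the normalized extremal form of depth `1` and weight `6 k + 2`. -/
def extremalA : ℕ → ℍ → ℂ := threeTerm 0 ((1008⁻¹ : ℂ) • (ModularForm.E₄ * ModularForm.E₄ : ℍ → ℂ))

/-- The normalized extremal form of depth `1` and weight `6 k + 2`. -/
def extremalForm : ℕ → ℍ → ℂ := threeTerm EisensteinSeries.E2
  ((1008⁻¹ : ℂ) • (ModularForm.E₄ * ModularForm.E₄ - ModularForm.E₆ * EisensteinSeries.E2))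

lemma isModular_extremalA (k : ℕ) : IsModular (6 * k + 2) (extremalA k) :=
  isModular_threeTerm (.zero 2) ((isModular_E₄.mul isModular_E₄).smul _) k

lemma isModular_extremalB (k : ℕ) : IsModular (6 * k) (extremalB k) :=
  (isModular_threeTerm (w := 0) (.const 1) (isModular_E₆.smul _) k).cast (by simp)

lemma extremalForm_eq (k : ℕ) :
    extremalForm k = extremalA k + extremalB k * EisensteinSeries.E2 := by
  unfold extremalForm extremalA extremalB
  induction k using Nat.twoStepInduction with
  | zero => simp [threeTerm]
  | one =>
    ext z
    simp [threeTerm]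
    ring
  | more k h1 h2 =>
    rw [threeTerm, h1, h2, threeTerm, threeTerm]
    ext z
    simp
    ring

lemma holo_extremalForm (k : ℕ) : IsHolomorphicAtCusp (extremalForm k) :=
  holo_threeTerm isHolomorphicAtCusp_E2 (((isModular_E₄.holo.mul isModular_E₄.holo).sub
    (isModular_E₆.holo.mul isHolomorphicAtCusp_E2)).smul _) k

lemma muStar_natCast_ne_zero (k : ℕ) : muStar ((k : ℂ) + 1) ≠ 0 := by
  have h : muStar ((k : ℂ) + 1) =
      12 * (6 * k + 5 : ℕ) * (6 * k + 13 : ℕ) / ((k + 1 : ℕ) * (k + 2 : ℕ)) := by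
    simp only [muStar]
    push_cast
    ring
  rw [h]
  refine div_ne_zero (mul_ne_zero (mul_ne_zero (by norm_num) ?_) ?_) (mul_ne_zero ?_ ?_) <;>
    exact Nat.cast_ne_zero.mpr (by omega)

/-- This is the Casoratian of two solutions of the recursion. Each step multiplies it by
`-(μ*_{k+1})⁻¹Δ`, and for `k = 0` it is `E₄²/1008`. -/
lemma det_extremalForm (k : ℕ) : ∃ c : ℂ, c ≠ 0 ∧
    extremalForm (k + 1) * extremalB k - extremalForm k * extremalB (k + 1) =
      c • (ModularForm.E₄ * ModularForm.E₄ * ModularForm.discriminant ^ k) := by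
  induction k with
  | zero =>
    refine ⟨1008⁻¹, by norm_num, ?_⟩
    ext z
    simp [extremalForm, extremalB, threeTerm]
    ring
  | succ k ih =>
    obtain ⟨c, hc, h⟩ := ih
    refine ⟨-(muStar ((k : ℂ) + 1))⁻¹ * c,
      mul_ne_zero (neg_ne_zero.mpr (inv_ne_zero (muStar_natCast_ne_zero k))) hc, ?_⟩
    ext z
    have hz := congrFun h z
    simp only [extremalForm, extremalB, threeTerm, Pi.sub_apply, Pi.mul_apply, Pi.smul_apply,
      smul_eq_mul, Pi.pow_apply] at hz ⊢
    linear_combination (-(muStar ((k : ℂ) + 1))⁻¹ * ModularForm.discriminant z) * hz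

lemma natCast_add_one_add_ne_zero (k n : ℕ) : (n : ℂ) + 1 + k ≠ 0 := by
  exact_mod_cast (by omega : n + 1 + k ≠ 0)

/-- After multiplication by `Δ^{k/2}E₄^{1/2}`, the relation `phiTail_sub` becomes the recursion that
defines `extremalForm`, and the two starting values agree. The order of vanishing, invisible in the
recursion, can be read off here. -/
lemma qExpansion_extremalForm (k : ℕ) : qExpansion 1 (extremalForm k) =
    X ^ k * phiTail (k : ℂ) * overField ℂ seriesSqrtDelta ^ k *
      overField ℂ (normSqrt seriesE₄) := by
  have hN : overField ℂ (normSqrt seriesE₄)⁻¹ * overField ℂ (normSqrt seriesE₄) = 1 := by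
    rw [mul_comm, overField, overField, ← map_mul,
      mul_inv_of_coeff_zero (coeff_zero_normSqrt _), map_one]
  have hS : overField ℂ seriesSqrtDelta⁻¹ * overField ℂ seriesSqrtDelta = 1 := by
    rw [mul_comm, overField, overField, ← map_mul,
      mul_inv_of_coeff_zero coeff_seriesSqrtDelta_zero, map_one]
  have h4 := isModular_E₄.holo
  have h6 := isModular_E₆.holo
  have h2 := isHolomorphicAtCusp_E2
  have hΔ := isModular_discriminant.holo
  have e6 : overField ℂ seriesE₆ = overField ℂ seriesE₄ * overField ℂ seriesT := by
    rw [← seriesE₄_mul_seriesT, overField, map_mul, overField, overField]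
  have eΔ : overField ℂ seriesDelta = X * overField ℂ seriesSqrtDelta ^ 2 := by
    rw [seriesDelta_eq, overField, map_mul, map_X, map_pow, overField]
  induction k using Nat.twoStepInduction with
  | zero =>
    have h := phiTail_zero (F := ℂ)
    rw [overField, map_mul, ← overField, ← overField] at h
    rw [extremalForm, threeTerm, Nat.cast_zero, ← map_seriesE₂, ← overField, h]
    linear_combination -(overField ℂ seriesE₂) * hN
  | one =>
    have h := phiTail_one (F := ℂ)
    rw [overField, map_mul, map_mul, map_sub, map_mul, map_pow, ← overField, ← overField,
      ← overField, ← overField, ← overField] at h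
    rw [extremalForm, threeTerm, ((h4.mul h4).sub (h6.mul h2)).qExpansion_smul,
      (h4.mul h4).qExpansion_sub (h6.mul h2), h4.qExpansion_mul h4, h6.qExpansion_mul h2,
      ← map_seriesE₂, ← map_seriesE₄, ← map_seriesE₆, Nat.cast_one, smul_eq_C_mul, ← overField,
      ← overField, ← overField]
    have hc : (C (1008⁻¹ : ℂ) * C (1008 : ℂ) : PowerSeries ℂ) = 1 := by
      rw [← map_mul, inv_mul_cancel₀ (by norm_num), map_one]
    set W := overField ℂ seriesE₄ ^ 2 - overField ℂ seriesE₆ * overField ℂ seriesE₂ with hW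
    rw [show overField ℂ seriesE₄ * overField ℂ seriesE₄ -
      overField ℂ seriesE₆ * overField ℂ seriesE₂ = W by rw [hW]; ring]
    set n := overField ℂ (normSqrt seriesE₄)
    set n' := overField ℂ (normSqrt seriesE₄)⁻¹
    set s := overField ℂ seriesSqrtDelta
    linear_combination X * phiTail (1 : ℂ) * s * n * hc - C (1008⁻¹ : ℂ) * s * n * h -
      C (1008⁻¹ : ℂ) * W * n' * n * hS - C (1008⁻¹ : ℂ) * W * hN
  | more k ih1 ih2 =>
    rw [extremalForm, threeTerm, ← extremalForm, ((hΔ.mul (holo_extremalForm k)).sub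
      (h6.mul (holo_extremalForm (k + 1)))).qExpansion_smul,
      (hΔ.mul (holo_extremalForm k)).qExpansion_sub (h6.mul (holo_extremalForm (k + 1))),
      hΔ.qExpansion_mul (holo_extremalForm k), h6.qExpansion_mul (holo_extremalForm (k + 1)),
      ih1, ih2, ← map_seriesE₆, ← map_seriesDelta, ← overField, ← overField, e6, eΔ,
      smul_eq_C_mul]
    have h := phiTail_sub (natCast_add_one_add_ne_zero k)
    rw [shiftFactor] at h
    have hc : (C (muStar ((k : ℂ) + 1))⁻¹ * C (muStar ((k : ℂ) + 1)) : PowerSeries ℂ) = 1 := by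
      rw [← map_mul, inv_mul_cancel₀ (muStar_natCast_ne_zero k), map_one]
    push_cast
    set n := overField ℂ (normSqrt seriesE₄)
    set s := overField ℂ seriesSqrtDelta
    set c' : PowerSeries ℂ := C (muStar ((k : ℂ) + 1))⁻¹
    linear_combination c' * X ^ (k + 1) * s ^ (k + 2) * n * h +
      X ^ (k + 2) * phiTail ((k : ℂ) + 2) * s ^ (k + 2) * n * hc +
      c' * X ^ (k + 1) * s ^ (k + 1) * n * overField ℂ seriesE₄ * overField ℂ seriesT *
        phiTail ((k : ℂ) + 1) * hS

lemma X_pow_dvd_qExpansion_extremalForm (k : ℕ) :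
    (X : PowerSeries ℂ) ^ k ∣ qExpansion 1 (extremalForm k) := by
  rw [qExpansion_extremalForm, mul_assoc, mul_assoc]
  exact dvd_mul_right _ _

lemma coeff_pow_zero_of_coeff_zero {f : PowerSeries ℂ} (h : f.coeff 0 = 1) (k : ℕ) :
    (f ^ k).coeff 0 = 1 := by
  rw [coeff_zero_eq_constantCoeff_apply] at *
  rw [map_pow, h, one_pow]

lemma coeff_qExpansion_extremalForm (k : ℕ) : (qExpansion 1 (extremalForm k)).coeff k = 1 := by
  rw [qExpansion_extremalForm, mul_assoc, mul_assoc]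
  have := coeff_X_pow_mul (phiTail (k : ℂ) *
    (overField ℂ seriesSqrtDelta ^ k * overField ℂ (normSqrt seriesE₄))) k 0
  rw [zero_add] at this
  rw [this, coeff_zero_mul', coeff_zero_mul', coeff_phiTail_zero,
    coeff_pow_zero_of_coeff_zero (coeff_overField_zero coeff_seriesSqrtDelta_zero),
    coeff_overField_zero (coeff_zero_normSqrt _), one_mul, one_mul]

lemma qExpansion_ne_zero_of_coeff {f : ℍ → ℂ} {n : ℕ} (h : (qExpansion 1 f).coeff n = 1) :
    qExpansion 1 f ≠ 0 := by
  intro h0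
  rw [h0] at h
  simp at h

lemma det_extremalForm_mul_eq_zero {f : ℍ → ℂ} (hf : IsHolomorphicAtCusp f) (k : ℕ)
    (h : f * (extremalForm (k + 1) * extremalB k - extremalForm k * extremalB (k + 1)) = 0) :
    f = 0 := by
  obtain ⟨c, hc, hdet⟩ := det_extremalForm k
  have hf4 : f * (ModularForm.E₄ * ModularForm.E₄ : ℍ → ℂ) = 0 := by
    ext z
    have hz := congrFun h z
    rw [hdet] at hz
    simpa [hc, ModularForm.discriminant_ne_zero] using hz
  have h4 := isModular_E₄.holo
  have hq := congrArg (qExpansion 1) hf4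
  rw [hf.qExpansion_mul (h4.mul h4), h4.qExpansion_mul h4, qExpansion_zero] at hq
  have h40 := qExpansion_ne_zero_of_coeff coeff_zero_qExpansion_E₄
  exact hf.eq_zero_iff.mp (by simpa [h40] using hq)

/-- A quasimodular form of depth at most `1` and weight `6 k + 2` that is `O(q ^ (k + 1))` is
zero. -/
theorem eq_zero_of_X_pow_succ_dvd {k : ℕ} {a b : ℍ → ℂ} (ha : IsModular (6 * k + 2) a)
    (hb : IsModular (6 * k) b)
    (h : (X : PowerSeries ℂ) ^ (k + 1) ∣ qExpansion 1 (a + b * EisensteinSeries.E2)) :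
    a + b * EisensteinSeries.E2 = 0 := by
  have hE := isHolomorphicAtCusp_E2
  set f := a + b * EisensteinSeries.E2 with hf
  have hfh : IsHolomorphicAtCusp f := ha.holo.add (hb.holo.mul hE)
  -- The terms in `E₂` cancel, leaving a modular form `aB_j - A_jb`.
  have hmod (j : ℕ) : IsModular (6 * k + 2 + 6 * j) (f * extremalB j - extremalForm j * b) := by
    have e : f * extremalB j - extremalForm j * b = a * extremalB j - extremalA j * b := by
      rw [hf, extremalForm_eq]
      ring
    rw [e]
    exact (ha.mul (isModular_extremalB j)).sub
      (((isModular_extremalA j).mul hb).cast (by ring))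
  have hq (j : ℕ) : qExpansion 1 (f * extremalB j - extremalForm j * b) =
      qExpansion 1 f * qExpansion 1 (extremalB j) -
        qExpansion 1 (extremalForm j) * qExpansion 1 b := by
    have h1 := (isModular_extremalB j).holo
    rw [(hfh.mul h1).qExpansion_sub ((holo_extremalForm j).mul hb.holo), hfh.qExpansion_mul h1,
      (holo_extremalForm j).qExpansion_mul hb.holo]
  -- The weight is `12k + 2` and the order is at least `k`.
  have h1 : f * extremalB k - extremalForm k * b = 0 := by
    refine ((hmod k).cast (by ring)).eq_zero_of_X_pow_dvd (k := k) ?_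
    rw [hq]
    exact ((dvd_of_mul_right_dvd (pow_succ (X : PowerSeries ℂ) k ▸ h :)).mul_right _).sub
      ((X_pow_dvd_qExpansion_extremalForm k).mul_right _)
  -- In `fB_k = f_kb` the left side is `O(q^{k+1})` while `f_k` has order exactly `k`, so `b`
  -- vanishes at the cusp.
  have hb1 : (X : PowerSeries ℂ) ∣ qExpansion 1 b := by
    have h2 := hq k
    rw [h1, qExpansion_zero] at h2
    obtain ⟨u, hu⟩ := X_pow_dvd_qExpansion_extremalForm k
    have hu0 : u.coeff 0 = 1 := by
      rw [← coeff_qExpansion_extremalForm k, hu, coeff_X_pow_mul', if_pos le_rfl, Nat.sub_self]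
    have h3 : (X : PowerSeries ℂ) ^ k * X ∣ X ^ k * (u * qExpansion 1 b) := by
      rw [← pow_succ, ← mul_assoc, ← hu, ← sub_eq_zero.mp h2.symm]
      exact h.mul_right _
    rw [mul_dvd_mul_iff_left (pow_ne_zero k X_ne_zero)] at h3
    refine (X_prime.dvd_or_dvd h3).resolve_left fun h4 => ?_
    rw [X_dvd_iff, ← coeff_zero_eq_constantCoeff_apply, hu0] at h4
    exact one_ne_zero h4
  cases k with
  | zero =>
    have hb0 : b = 0 := hb.eq_zero_of_coeff (n := 1) (by simp) fun i hi => by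
      obtain rfl : i = 0 := by omega
      simpa using X_dvd_iff.mp hb1
    have ha0 : a = 0 := ((ha.cast (by simp)).eq_zero_of_X_pow_dvd (k := 0) (by simp))
    rw [hf, ha0, hb0]
    simp
  | succ k =>
    -- Here `f` has weight `6(k + 1) + 2`, so this form has weight `12k + 8 < 12(k + 1)`. Its order
    -- is at least `k + 1`, thanks to the zero of `b`.
    have h2 : f * extremalB k - extremalForm k * b = 0 := by
      refine (hmod k).eq_zero_of_coeff (n := k + 1) (by push_cast; linarith) ?_
      rw [← X_pow_dvd_iff, hq]
      refine (((pow_dvd_pow _ (by omega)).trans h).mul_right _).sub ?_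
      rw [pow_succ]
      exact mul_dvd_mul (X_pow_dvd_qExpansion_extremalForm k) hb1
    -- Eliminating `b` from the two relations leaves `f` times the Casoratian.
    refine det_extremalForm_mul_eq_zero hfh k ?_
    linear_combination extremalForm (k + 1) * h2 - extremalForm k * h1

lemma mem_quasimodularForms_one_iff {k : ℕ} {f : ℍ → ℂ} :
    f ∈ QuasimodularForms 1 (6 * k + 2) ↔ ∃ a b, IsModular (6 * k + 2) a ∧ IsModular (6 * k) b ∧
      f = a + b * EisensteinSeries.E2 := by
  constructor
  · rintro ⟨g, hg⟩
    refine ⟨g 0, g 1, IsModular.cast ⟨g 0, rfl⟩ (by simp),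
      IsModular.cast ⟨g 1, rfl⟩ (by push_cast; ring), ?_⟩
    ext z
    rw [hg]
    simp [Finset.sum_range_succ]
  · rintro ⟨a, b, ha, hb, rfl⟩
    have h (j : ℕ) : IsModular (((6 * k + 2 : ℕ) : ℤ) - 2 * (j : ℤ))
        (if j = 0 then a else if j = 1 then b else 0) := by
      split_ifs with h0 h1
      · exact ha.cast (by simp [h0])
      · exact hb.cast (by rw [h1]; push_cast; ring)
      · exact .zero _
    choose g hg using h
    refine ⟨g, fun z => ?_⟩
    simp [Finset.sum_range_succ, hg]

lemma holo_of_mem {k : ℕ} {f : ℍ → ℂ} (hf : f ∈ QuasimodularForms 1 (6 * k + 2)) :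
    IsHolomorphicAtCusp f := by
  obtain ⟨a, b, ha, hb, rfl⟩ := mem_quasimodularForms_one_iff.mp hf
  exact ha.holo.add (hb.holo.mul isHolomorphicAtCusp_E2)

lemma extremalForm_mem (k : ℕ) : extremalForm k ∈ QuasimodularForms 1 (6 * k + 2) :=
  mem_quasimodularForms_one_iff.mpr
    ⟨_, _, isModular_extremalA k, isModular_extremalB k, extremalForm_eq k⟩

/-- The first `n` coefficients of the `q`-expansion. -/
def coeffMap (k n : ℕ) : QuasimodularForms 1 (6 * k + 2) →ₗ[ℂ] Fin n → ℂ where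
  toFun f i := (qExpansion 1 (f : ℍ → ℂ)).coeff i
  map_add' f g := by
    ext i
    simp [(holo_of_mem f.2).qExpansion_add (holo_of_mem g.2)]
  map_smul' c f := by
    ext i
    simp [(holo_of_mem f.2).qExpansion_smul]

lemma coeffMap_injective (k : ℕ) : Function.Injective (coeffMap k (k + 1)) := by
  rw [injective_iff_map_eq_zero]
  intro f hf
  obtain ⟨a, b, ha, hb, h⟩ := mem_quasimodularForms_one_iff.mp f.2
  apply Subtype.ext
  rw [h]
  refine eq_zero_of_X_pow_succ_dvd ha hb ?_
  rw [← h, X_pow_dvd_iff]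
  intro m hm
  exact congrFun hf ⟨m, hm⟩

lemma mul_extremalForm_mem {k j : ℕ} (hj : j ≤ k) :
    (ModularForm.E₆ ^ (k - j) * extremalForm j : ℍ → ℂ) ∈ QuasimodularForms 1 (6 * k + 2) := by
  refine mem_quasimodularForms_one_iff.mpr ⟨ModularForm.E₆ ^ (k - j) * extremalA j,
    ModularForm.E₆ ^ (k - j) * extremalB j,
    ((isModular_E₆.pow (k - j)).mul (isModular_extremalA j)).cast (by push_cast [hj]; ring),
    ((isModular_E₆.pow (k - j)).mul (isModular_extremalB j)).cast (by push_cast [hj]; ring), ?_⟩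
  rw [extremalForm_eq]
  ring

lemma coeff_mul_extremalForm {k : ℕ} (i j : ℕ) (hij : i ≤ j) :
    (qExpansion 1 (ModularForm.E₆ ^ (k - j) * extremalForm j : ℍ → ℂ)).coeff i =
      if i = j then 1 else 0 := by
  have h6 : (qExpansion 1 (ModularForm.E₆ ^ (k - j) : ℍ → ℂ)).coeff 0 = 1 := by
    generalize k - j = n
    induction n with
    | zero => rw [pow_zero, qExpansion_one, coeff_zero_one]
    | succ n ih =>
      rw [pow_succ, (isModular_E₆.pow n).holo.qExpansion_mul isModular_E₆.holo, coeff_zero_mul', ih,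
        coeff_zero_qExpansion_E₆, one_mul]
  rw [(isModular_E₆.pow _).holo.qExpansion_mul (holo_extremalForm j)]
  obtain ⟨u, hu⟩ := X_pow_dvd_qExpansion_extremalForm j
  have hu0 : u.coeff 0 = 1 := by
    rw [← coeff_qExpansion_extremalForm j, hu, coeff_X_pow_mul', if_pos le_rfl, Nat.sub_self]
  rw [hu, mul_left_comm, coeff_X_pow_mul']
  split_ifs with h1 h2 h2
  · rw [h2, Nat.sub_self, coeff_zero_mul', h6, hu0, one_mul]
  · omega
  · omega
  · rfl

lemma finrank_quasimodularForms (k : ℕ) :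
    Module.finrank ℂ (QuasimodularForms 1 (6 * k + 2)) = k + 1 := by
  have hinj := coeffMap_injective k
  have hfin : FiniteDimensional ℂ (QuasimodularForms 1 (6 * k + 2)) :=
    FiniteDimensional.of_injective _ hinj
  refine le_antisymm (by simpa using LinearMap.finrank_le_finrank_of_injective hinj) ?_
  -- The forms `E₆^{k-j}f_j = q^j + O(q^{j+1})` have a unitriangular matrix of coefficients, so the
  -- dimension is at least `k + 1`.
  let v (j : Fin (k + 1)) : QuasimodularForms 1 (6 * k + 2) :=
    ⟨_, mul_extremalForm_mem (Nat.lt_succ_iff.mp j.2)⟩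
  have hv : LinearIndependent ℂ v := by
    refine LinearIndependent.of_comp (coeffMap k (k + 1)) ?_
    let M : Matrix (Fin (k + 1)) (Fin (k + 1)) ℂ := Matrix.of fun j i => coeffMap k (k + 1) (v j) i
    have hM : M.det = 1 := by
      rw [Matrix.det_of_isUpperTriangular]
      · refine Finset.prod_eq_one fun i _ => ?_
        exact (coeff_mul_extremalForm (k := k) i i le_rfl).trans (if_pos rfl)
      · intro i j hij
        have hij' : (j : ℕ) < i := hij
        exact (coeff_mul_extremalForm (k := k) j i hij'.le).trans (if_neg hij'.ne)
    have := Matrix.linearIndependent_rows_iff_isUnit.mpr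
      ((Matrix.isUnit_iff_isUnit_det M).mpr (hM ▸ isUnit_one))
    exact this
  simpa using hv.fintype_card_le_finrank

lemma isNormalizedExtremal_extremalForm (k : ℕ) :
    IsNormalizedExtremal 1 (6 * k + 2) (extremalForm k) where
  mem := extremalForm_mem k
  notMem := by
    intro l hl ⟨g, hg⟩
    obtain rfl : l = 0 := by omega
    have h : IsModular (6 * k + 2) (extremalForm k) :=
      IsModular.cast ⟨g 0, by ext z; simp [hg]⟩ (by simp)
    -- A modular form of weight `6k + 2 < 12k` and order at least `k` is zero; for `k = 0` the
    -- weight is 2.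
    have h0 : extremalForm k = 0 := by
      rcases k.eq_zero_or_pos with rfl | hk
      · exact (h.cast (by simp)).eq_zero_of_X_pow_dvd (k := 0) (by simp)
      · exact h.eq_zero_of_coeff (n := k) (by norm_cast; omega)
          (X_pow_dvd_iff.mp (X_pow_dvd_qExpansion_extremalForm k))
    exact qExpansion_ne_zero_of_coeff (coeff_qExpansion_extremalForm k)
      (by rw [h0, qExpansion_zero])
  coeff_eq_zero := by
    intro n hn
    rw [finrank_quasimodularForms] at hn
    exact X_pow_dvd_iff.mp (X_pow_dvd_qExpansion_extremalForm k) n (by omega)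
  coeff_eq_one := by
    rw [finrank_quasimodularForms]
    exact coeff_qExpansion_extremalForm k

lemma IsNormalizedExtremal.eq_extremalForm {k : ℕ} {f : ℍ → ℂ}
    (hf : IsNormalizedExtremal 1 (6 * k + 2) f) : f = extremalForm k := by
  have h1 : (⟨f, hf.mem⟩ : QuasimodularForms 1 (6 * k + 2)) =
      ⟨extremalForm k, extremalForm_mem k⟩ := by
    apply coeffMap_injective k
    ext ⟨i, hi⟩
    have hc := hf.coeff_eq_zero
    have hc1 := hf.coeff_eq_one
    have hg := isNormalizedExtremal_extremalForm k
    have hd := hg.coeff_eq_zero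
    have hd1 := hg.coeff_eq_one
    rw [finrank_quasimodularForms] at hc hc1 hd hd1
    change (qExpansion 1 f).coeff i = (qExpansion 1 (extremalForm k)).coeff i
    rcases (Nat.lt_succ_iff.mp hi).lt_or_eq with h | rfl
    · rw [hc i (by omega), hd i (by omega)]
    · exact hc1.trans hd1.symm
  exact congrArg Subtype.val h1

end ExtremalForms
end

noncomputable section

/-! ### Passage to Laurent series in t = q^{1/2} -/

section HalfPowers

open PowerSeries

variable {K L : Type*} [Field K] [Field L]

lemma inHalfPowers_mul (f g : PowerSeries K) :
    inHalfPowers (f * g) = inHalfPowers f * inHalfPowers g := by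
  simp only [inHalfPowers, map_mul]

lemma inHalfPowers_sub (f g : PowerSeries K) :
    inHalfPowers (f - g) = inHalfPowers f - inHalfPowers g := by
  simp only [inHalfPowers, map_sub]

lemma inHalfPowers_one : inHalfPowers (1 : PowerSeries K) = 1 := by
  simp only [inHalfPowers, map_one]

lemma inHalfPowers_pow (f : PowerSeries K) (n : ℕ) :
    inHalfPowers (f ^ n) = inHalfPowers f ^ n := by
  simp only [inHalfPowers, map_pow]

lemma inHalfPowers_X :
    inHalfPowers (X : PowerSeries K) = HahnSeries.single 1 1 * HahnSeries.single 1 1 := by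
  rw [inHalfPowers, expand_X, map_pow, HahnSeries.ofPowerSeries_X, sq]

lemma inHalfPowers_C (c : K) : inHalfPowers (C c) = HahnSeries.C c := by
  rw [inHalfPowers, expand_C, HahnSeries.ofPowerSeries_C]

lemma inHalfPowers_injective : Function.Injective (inHalfPowers : PowerSeries K → _) := by
  intro f g h
  have h' := HahnSeries.ofPowerSeries_injective h
  ext n
  rw [← coeff_expand_mul 2 two_ne_zero f, h', coeff_expand_mul]

lemma map_inHalfPowers (σ : K →+* L) (f : PowerSeries K) :
    (inHalfPowers f).map σ = inHalfPowers (f.map σ) := by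
  ext n
  rw [HahnSeries.map_coeff, inHalfPowers, inHalfPowers, ← map_expand]
  rw [PowerSeries.coeff_coe, PowerSeries.coeff_coe]
  split_ifs
  · exact map_zero σ
  · rw [coeff_map]

lemma inHalfPowers_inv {f : PowerSeries K} (hf : f.coeff 0 = 1) :
    inHalfPowers f⁻¹ = (inHalfPowers f)⁻¹ := by
  refine eq_inv_of_mul_eq_one_left ?_
  rw [← inHalfPowers_mul, mul_comm, mul_inv_of_coeff_zero hf, inHalfPowers_one]

lemma inHalfPowers_ne_zero {f : PowerSeries K} (hf : f ≠ 0) : inHalfPowers f ≠ 0 := fun h =>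
  hf (inHalfPowers_injective (h.trans (by simp only [inHalfPowers, map_zero])))

lemma map_normSqrt (σ : K →+* L) (f : PowerSeries K) :
    (normSqrt f).map σ = normSqrt (f.map σ) := by
  ext n
  simp only [normSqrt, coeff_map, coeff_mk]
  induction n using Nat.strong_induction_on with
  | _ n ih =>
    cases n with
    | zero => simp [sqrtCoeff]
    | succ n =>
      rw [sqrtCoeff, sqrtCoeff, map_div₀, map_sub, map_sum, map_ofNat, coeff_map]
      congr 2
      refine Finset.sum_congr rfl fun i _ => ?_
      rw [map_mul, ih _ (by omega), ih _ (by omega)]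

lemma single_one_ne_zero (n : ℤ) : (HahnSeries.single n 1 : LaurentSeries K) ≠ 0 :=
  HahnSeries.single_ne_zero one_ne_zero

lemma single_one_pow (n : ℕ) :
    (HahnSeries.single 1 1 : LaurentSeries K) ^ n = HahnSeries.single (n : ℤ) 1 := by
  simp

/-- The common form of (a) and (b): `phiTail_sub` rewritten with `q = t²` and `th = E₆(Δ/q)^{-1/2}`,
the power `q^{κ/2}` being removed. -/
lemma single_one_mul_phiTail_sub [CharZero K] {κ : K} {h : LaurentSeries K}
    (hκ : ∀ n : ℕ, (n : K) + 1 + κ ≠ 0) (hμ : muStar (κ + 1) ≠ 0)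
    (hh : HahnSeries.single 1 1 * h = inHalfPowers (shiftFactor K)) :
    HahnSeries.single 1 1 * (HahnSeries.single 1 1 * inHalfPowers (phiTail (κ + 2))) +
      HahnSeries.C (muStar (κ + 1))⁻¹ *
        (h * (HahnSeries.single 1 1 * inHalfPowers (phiTail (κ + 1))) -
          inHalfPowers (phiTail κ)) = 0 := by
  have key := congrArg inHalfPowers (phiTail_sub hκ)
  rw [inHalfPowers_sub, inHalfPowers_mul, inHalfPowers_mul, inHalfPowers_mul, inHalfPowers_X,
    inHalfPowers_C, ← hh] at key
  have hC : (HahnSeries.C (muStar (κ + 1))⁻¹ : LaurentSeries K) * HahnSeries.C (muStar (κ + 1))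
      = 1 := by
    rw [← map_mul, inv_mul_cancel₀ hμ, map_one]
  linear_combination (-HahnSeries.C (muStar (κ + 1))⁻¹) * key -
    (HahnSeries.single 1 1 * HahnSeries.single 1 1 * inHalfPowers (phiTail (κ + 2))) * hC

end HalfPowers

/-! ### The identity for families indexed by the integers -/

section PhiSeries

open PowerSeries

lemma sqrtE₄_eq : sqrtE₄ = inHalfPowers (overField ℂ (normSqrt seriesE₄)) := by
  rw [sqrtE₄, overField, map_normSqrt, map_seriesE₄]

lemma sqrtDelta_eq :
    sqrtDelta = HahnSeries.single 1 1 * inHalfPowers (overField ℂ seriesSqrtDelta) := by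
  rw [sqrtDelta, overField, seriesSqrtDelta, map_normSqrt, ← map_seriesDelta]
  rfl

lemma overField_mul {F : Type*} [Field F] [CharZero F] (f g : PowerSeries ℚ) :
    overField F (f * g) = overField F f * overField F g := map_mul _ f g

lemma overField_inv {F : Type*} [Field F] [CharZero F] {f : PowerSeries ℚ} (h : f.coeff 0 = 1) :
    overField F f⁻¹ = (overField F f)⁻¹ := by
  refine (PowerSeries.eq_inv_iff_mul_eq_one
    (constantCoeff_ne_zero_of_coeff (coeff_overField_zero h))).mpr ?_
  rw [← overField_mul, mul_comm, mul_inv_of_coeff_zero h, overField, map_one]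

lemma single_mul_E₆DivSqrtDelta :
    HahnSeries.single 1 1 * E₆DivSqrtDelta = inHalfPowers (shiftFactor ℂ) := by
  rw [E₆DivSqrtDelta, sqrtDelta_eq, ← map_seriesE₆, ← seriesE₄_mul_seriesT, shiftFactor,
    inHalfPowers_mul, ← overField_mul, overField_inv coeff_seriesSqrtDelta_zero,
    inHalfPowers_inv (coeff_overField_zero coeff_seriesSqrtDelta_zero), mul_inv]
  change _ * (inHalfPowers (overField ℂ (seriesE₄ * seriesT)) * _) = _
  have := single_one_ne_zero (K := ℂ) 1
  field_simp

lemma phiSeries_extremalForm (k : ℕ) : phiSeries (extremalForm k) k =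
    HahnSeries.single (k : ℤ) 1 * inHalfPowers (phiTail (k : ℂ)) := by
  have h1 := single_one_ne_zero (K := ℂ) 1
  have h2 : inHalfPowers (overField ℂ seriesSqrtDelta) ≠ 0 := inHalfPowers_ne_zero
    (ne_zero_of_coeff_zero (coeff_overField_zero coeff_seriesSqrtDelta_zero))
  have h3 : inHalfPowers (overField ℂ (normSqrt seriesE₄)) ≠ 0 := inHalfPowers_ne_zero
    (ne_zero_of_coeff_zero (coeff_overField_zero (coeff_zero_normSqrt _)))
  rw [phiSeries, qExpansion_extremalForm, sqrtE₄_eq, sqrtDelta_eq, ← single_one_pow]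
  simp only [inHalfPowers_mul, inHalfPowers_pow, inHalfPowers_X, mul_pow, inv_pow, mul_inv]
  field_simp

theorem opPsi_shiftFamily_extremalForm :
    opPsi shiftFamily (fun _ => E₆DivSqrtDelta) (fun k => HahnSeries.C (muStar ((k : ℂ) + 1))⁻¹)
      (fun k => phiSeries (extremalForm k) k) = 0 := by
  funext k
  have key := single_one_mul_phiTail_sub (natCast_add_one_add_ne_zero k)
    (muStar_natCast_ne_zero k) single_mul_E₆DivSqrtDelta
  simp only [opPsi, shiftFamily, Pi.add_apply, Pi.mul_apply, Pi.sub_apply, Pi.zero_apply,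
    phiSeries_extremalForm]
  simp only [← single_one_pow, pow_succ]
  have e : ((k + 1 + 1 : ℕ) : ℂ) = k + 2 := by push_cast; ring
  rw [e, Nat.cast_succ]
  linear_combination HahnSeries.single 1 1 ^ k * key

end PhiSeries

end

noncomputable section

/-! ### Values of rational functions at the integers -/

section RationalValues

open Polynomial

/-- The rational function `r` has no pole at `x` and its value there is `v`. -/
def HasValueAt (x : ℚ) (r : RatFunc ℚ) (v : ℂ) : Prop :=
  ∃ p q : ℚ[X], q.eval x ≠ 0 ∧ r * algebraMap ℚ[X] (RatFunc ℚ) q = algebraMap ℚ[X] (RatFunc ℚ) p ∧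
    v * (q.eval x : ℚ) = (p.eval x : ℚ)

variable {x : ℚ} {r s : RatFunc ℚ} {v w : ℂ}

lemma hasValueAt_algebraMap (x : ℚ) (p : ℚ[X]) :
    HasValueAt x (algebraMap ℚ[X] (RatFunc ℚ) p) (p.eval x : ℚ) :=
  ⟨p, 1, by simp, by simp, by simp⟩

lemma hasValueAt_X (x : ℚ) : HasValueAt x RatFunc.X (x : ℂ) := by
  simpa using hasValueAt_algebraMap x X

lemma hasValueAt_ratCast (x c : ℚ) : HasValueAt x (c : RatFunc ℚ) (c : ℂ) := by
  simpa using hasValueAt_algebraMap x (Polynomial.C c)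

lemma HasValueAt.add (hr : HasValueAt x r v) (hs : HasValueAt x s w) :
    HasValueAt x (r + s) (v + w) := by
  obtain ⟨p₁, q₁, h₁, e₁, f₁⟩ := hr
  obtain ⟨p₂, q₂, h₂, e₂, f₂⟩ := hs
  refine ⟨p₁ * q₂ + p₂ * q₁, q₁ * q₂, by simp [h₁, h₂], ?_, ?_⟩
  · simp only [map_add, map_mul]
    linear_combination algebraMap ℚ[X] (RatFunc ℚ) q₂ * e₁ + algebraMap ℚ[X] (RatFunc ℚ) q₁ * e₂
  · simp only [eval_add, eval_mul, Rat.cast_add, Rat.cast_mul]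
    linear_combination ((q₂.eval x : ℚ) : ℂ) * f₁ + ((q₁.eval x : ℚ) : ℂ) * f₂

lemma HasValueAt.mul (hr : HasValueAt x r v) (hs : HasValueAt x s w) :
    HasValueAt x (r * s) (v * w) := by
  obtain ⟨p₁, q₁, h₁, e₁, f₁⟩ := hr
  obtain ⟨p₂, q₂, h₂, e₂, f₂⟩ := hs
  refine ⟨p₁ * p₂, q₁ * q₂, by simp [h₁, h₂], ?_, ?_⟩
  · rw [map_mul, map_mul, ← e₁, ← e₂]
    ring
  · rw [eval_mul, eval_mul, Rat.cast_mul, Rat.cast_mul, ← f₁, ← f₂]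
    ring

lemma HasValueAt.div (hr : HasValueAt x r v) (hs : HasValueAt x s w) (hw : w ≠ 0) :
    HasValueAt x (r / s) (v / w) := by
  obtain ⟨p₁, q₁, h₁, e₁, f₁⟩ := hr
  obtain ⟨p₂, q₂, h₂, e₂, f₂⟩ := hs
  have hp₂ : p₂.eval x ≠ 0 := fun h => by
    rw [h, Rat.cast_zero, mul_eq_zero, Rat.cast_eq_zero] at f₂
    exact f₂.elim hw h₂
  have hs0 : s ≠ 0 := by
    rintro rfl
    rw [zero_mul, eq_comm, map_eq_zero_iff _ (RatFunc.algebraMap_injective ℚ)] at e₂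
    simp [e₂] at hp₂
  refine ⟨p₁ * q₂, q₁ * p₂, by simp [h₁, hp₂], ?_, ?_⟩
  · rw [map_mul, map_mul, ← e₁, ← e₂]
    field_simp
  · rw [eval_mul, eval_mul, Rat.cast_mul, Rat.cast_mul, ← f₁, ← f₂]
    field_simp

lemma HasValueAt.sum {ι : Type*} {S : Finset ι} {r : ι → RatFunc ℚ} {v : ι → ℂ}
    (h : ∀ i ∈ S, HasValueAt x (r i) (v i)) : HasValueAt x (∑ i ∈ S, r i) (∑ i ∈ S, v i) := by
  induction S using Finset.cons_induction with
  | empty => simpa using hasValueAt_ratCast x 0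
  | cons a S ha ih =>
    rw [Finset.sum_cons, Finset.sum_cons]
    exact (h a (Finset.mem_cons_self a S)).add
      (ih fun i hi => h i (Finset.mem_cons_of_mem hi))

/-- The reduced denominator divides the denominator of any representing fraction. So `HasValueAt`
may use unreduced fractions, which makes it stable under arithmetic. -/
lemma HasValueAt.denom_eval_ne_zero (h : HasValueAt x r v) : r.denom.eval x ≠ 0 := by
  obtain ⟨p, q, hq, e, -⟩ := h
  have hq0 : q ≠ 0 := by rintro rfl; simp at hq
  have hr : r = algebraMap ℚ[X] (RatFunc ℚ) p / algebraMap ℚ[X] (RatFunc ℚ) q :=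
    eq_div_of_mul_eq (RatFunc.algebraMap_ne_zero hq0) e
  obtain ⟨d, hd⟩ := RatFunc.denom_div_dvd p q
  rw [← hr] at hd
  intro h0
  rw [hd, eval_mul, h0, zero_mul] at hq
  exact hq rfl

lemma RatFunc.mul_denom_eq_num (r : RatFunc ℚ) :
    r * algebraMap ℚ[X] (RatFunc ℚ) r.denom = algebraMap ℚ[X] (RatFunc ℚ) r.num := by
  conv_lhs => enter [1]; rw [← RatFunc.num_div_denom r]
  exact div_mul_cancel₀ _ (RatFunc.algebraMap_ne_zero r.denom_ne_zero)

lemma RatFunc.eval_ratCast (r : RatFunc ℚ) (x : ℚ) :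
    r.eval (algebraMap ℚ ℂ) (x : ℂ) = (r.num.eval x : ℚ) / (r.denom.eval x : ℚ) := by
  have h (p : ℚ[X]) : p.eval₂ (algebraMap ℚ ℂ) (x : ℂ) = (p.eval x : ℚ) := by
    have := (eval₂_at_apply (p := p) (algebraMap ℚ ℂ) x)
    simpa using this
  rw [RatFunc.eval, h, h]

lemma HasValueAt.eval_eq (h : HasValueAt x r v) : r.eval (algebraMap ℚ ℂ) (x : ℂ) = v := by
  have hd := h.denom_eval_ne_zero
  obtain ⟨p, q, hq, e, f⟩ := h
  have hpq : r.num * q = p * r.denom := by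
    apply RatFunc.algebraMap_injective ℚ
    rw [map_mul, map_mul, ← RatFunc.mul_denom_eq_num, ← e]
    ring
  have hpq' := congrArg (fun P : ℚ[X] => ((P.eval x : ℚ) : ℂ)) hpq
  simp only [eval_mul, Rat.cast_mul] at hpq'
  have hq' : ((q.eval x : ℚ) : ℂ) ≠ 0 := by exact_mod_cast hq
  have hd' : ((r.denom.eval x : ℚ) : ℂ) ≠ 0 := by exact_mod_cast hd
  rw [RatFunc.eval_ratCast, div_eq_iff hd']
  apply mul_right_cancel₀ hq'
  rw [hpq', ← f]
  ring

lemma RatFunc.eq_of_forall_natCast_eval_eq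
    (hr : ∀ k : ℕ, r.denom.eval (k : ℚ) ≠ 0) (hs : ∀ k : ℕ, s.denom.eval (k : ℚ) ≠ 0)
    (h : ∀ k : ℕ, r.eval (algebraMap ℚ ℂ) (k : ℂ) = s.eval (algebraMap ℚ ℂ) (k : ℂ)) : r = s := by
  have key : r.num * s.denom = s.num * r.denom := by
    refine eq_of_infinite_eval_eq _ _
      ((Set.infinite_range_of_injective (Nat.cast_injective (R := ℚ))).mono ?_)
    rintro _ ⟨k, rfl⟩
    have h' := h k
    rw [← Rat.cast_natCast, RatFunc.eval_ratCast, RatFunc.eval_ratCast,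
      div_eq_div_iff (Rat.cast_ne_zero.mpr (hr k)) (Rat.cast_ne_zero.mpr (hs k))] at h'
    rw [Set.mem_ofPred_eq, Polynomial.eval_mul, Polynomial.eval_mul]
    exact_mod_cast h'
  rw [← RatFunc.num_div_denom r, ← RatFunc.num_div_denom s,
    div_eq_div_iff (RatFunc.algebraMap_ne_zero r.denom_ne_zero)
      (RatFunc.algebraMap_ne_zero s.denom_ne_zero), ← map_mul, ← map_mul, key]

lemma hasValueAt_coeff_potential (k n : ℕ) :
    HasValueAt k ((potential (RatFunc.X : RatFunc ℚ)).coeff n)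
      ((potential (k : ℂ)).coeff n) := by
  -- Each coefficient is a quadratic polynomial in `κ` with rational coefficients independent of the
  -- field, so it specializes from `ℚ(k)` to `κ = k`.
  have h12 (F : Type) [Field F] [CharZero F] (κ : F) : (potential κ).coeff n =
      ((36 : ℚ) : F) * (κ * κ) * (seriesE₄.coeff n : ℚ) +
        ((12 * (seriesT ^ 2).coeff n - 12 * seriesE₄.coeff n : ℚ) : F) := by
    have e2 : overField F seriesT ^ 2 = overField F (seriesT ^ 2) := (map_pow _ _ _).symm
    rw [potential, e2, ← map_ofNat PowerSeries.C 12, ← map_pow, map_add, map_sub,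
      PowerSeries.coeff_C_mul, PowerSeries.coeff_C_mul, PowerSeries.coeff_C_mul, coeff_overField,
      coeff_overField]
    push_cast
    ring
  rw [h12, h12]
  have hX : HasValueAt k RatFunc.X (k : ℂ) := by simpa using hasValueAt_X k
  exact (((hasValueAt_ratCast _ _).mul (hX.mul hX)).mul (hasValueAt_ratCast _ _)).add
    (hasValueAt_ratCast _ _)

/-- The recursion is run in parallel over `ℚ(k)` and over `ℂ`. Its denominators `144(n + 1)(n + 1 +
k)` do not vanish at integers `k ≥ 0`. -/
lemma hasValueAt_coeff_phiTail (k n : ℕ) :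
    HasValueAt k ((phiTail (RatFunc.X : RatFunc ℚ)).coeff n) ((phiTail (k : ℂ)).coeff n) := by
  induction n using Nat.strong_induction_on with
  | _ n ih =>
    cases n with
    | zero => simpa [coeff_phiTail_zero] using hasValueAt_ratCast k 1
    | succ n =>
      rw [coeff_phiTail_succ, coeff_phiTail_succ]
      refine HasValueAt.div (HasValueAt.sum fun i _ =>
        (hasValueAt_coeff_potential k _).mul (ih i (by omega))) ?_ ?_
      · have h1 := (hasValueAt_ratCast k (144 * ((n : ℚ) + 1))).mul
          ((hasValueAt_ratCast k ((n : ℚ) + 1)).add (hasValueAt_X k))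
        push_cast at h1
        exact h1
      · exact mul_ne_zero (mul_ne_zero (by norm_num) (Nat.cast_add_one_ne_zero n))
          (natCast_add_one_add_ne_zero k n)

end RationalValues

/-! ### The rational coefficients, and the identity with k an indeterminate -/

section FormalParameter

lemma map_single_mul {K L : Type*} [Field K] [Field L] (σ : K →+* L) (g : LaurentSeries K) :
    (HahnSeries.single 1 1 * g).map σ = HahnSeries.single 1 1 * g.map σ := by
  have h1 := HahnSeries.map_mul (σ : K →ₙ+* L)
    (x := (HahnSeries.single 1 1 : LaurentSeries K)) (y := g)
  have h2 : (HahnSeries.single 1 1 : LaurentSeries K).map σ = HahnSeries.single 1 1 :=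
    (HahnSeries.map_single (a := (1 : ℤ)) σ.toZeroHom).trans (congrArg _ σ.map_one)
  rw [← h2]
  exact h1

lemma map_shiftFactor {F K : Type*} [Field F] [CharZero F] [Field K] [CharZero K] (σ : F →+* K) :
    (shiftFactor F).map σ = shiftFactor K := by
  have h (f : PowerSeries ℚ) : (overField F f).map σ = overField K f := by
    ext n
    rw [PowerSeries.coeff_map, coeff_overField, coeff_overField, map_ratCast]
  rw [shiftFactor, shiftFactor, map_mul, map_mul, h, h, h]

/-- The coefficients of `φ` as rational functions of `k`. -/
def phiCoeff (n : ℕ) : RatFunc ℚ := (phiTail (RatFunc.X : RatFunc ℚ)).coeff n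

lemma isRationalExpansion_phiCoeff :
    IsRationalExpansion (fun k => phiSeries (extremalForm k) k) phiCoeff := by
  refine fun k => ⟨fun n => (hasValueAt_coeff_phiTail k n).denom_eval_ne_zero, ?_⟩
  have h (n : ℕ) := (hasValueAt_coeff_phiTail k n).eval_eq
  simp only [Rat.cast_natCast] at h
  simp only [phiCoeff, h, phiSeries_extremalForm]
  congr 2
  ext n
  rw [PowerSeries.coeff_mk]

lemma IsRationalExpansion.unique {φ : ℕ → LaurentSeries ℂ} {α β : ℕ → RatFunc ℚ}
    (hα : IsRationalExpansion φ α) (hβ : IsRationalExpansion φ β) : α = β := by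
  funext n
  refine RatFunc.eq_of_forall_natCast_eval_eq (fun k => (hα k).1 n) (fun k => (hβ k).1 n)
    fun k => ?_
  have h := inHalfPowers_injective (mul_left_cancel₀ (single_one_ne_zero (k : ℤ))
    ((hα k).2.symm.trans (hβ k).2))
  simpa using congrArg (PowerSeries.coeff n) h

lemma ratFuncInclusion_X : ratFuncInclusion RatFunc.X = RatFunc.X := by
  rw [ratFuncInclusion, RatFunc.coe_mapRingHom_eq_coe_map, RatFunc.map_apply]
  simp

lemma shiftRatFunc_X : shiftRatFunc RatFunc.X = RatFunc.X + 1 := by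
  rw [shiftRatFunc, RatFunc.coe_mapRingHom_eq_coe_map, RatFunc.map_apply]
  simp

lemma formalSeries_phiCoeff :
    formalSeries phiCoeff = inHalfPowers (phiTail (RatFunc.X : RatFunc ℂ)) := by
  rw [← ratFuncInclusion_X, ← map_phiTail, formalSeries]
  congr 1
  ext n
  rw [PowerSeries.coeff_mk, PowerSeries.coeff_map, phiCoeff]

lemma shiftFormal_inHalfPowers_phiTail (κ : RatFunc ℂ) :
    shiftFormal (inHalfPowers (phiTail κ)) =
      HahnSeries.single 1 1 * inHalfPowers (phiTail (shiftRatFunc κ)) := by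
  rw [shiftFormal, map_inHalfPowers, map_phiTail]

lemma shiftFormal_single_mul (g : LaurentSeries (RatFunc ℂ)) :
    shiftFormal (HahnSeries.single 1 1 * g) = HahnSeries.single 1 1 * shiftFormal g := by
  rw [shiftFormal, shiftFormal]
  rw [map_single_mul]

lemma single_mul_constSeries_E₆DivSqrtDelta :
    HahnSeries.single 1 1 * constSeries E₆DivSqrtDelta =
      inHalfPowers (shiftFactor (RatFunc ℂ)) := by
  have h : (shiftFactor ℂ).map (RatFunc.C : ℂ →+* RatFunc ℂ) = shiftFactor (RatFunc ℂ) :=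
    map_shiftFactor _
  rw [← h, ← map_inHalfPowers, ← single_mul_E₆DivSqrtDelta, map_single_mul, constSeries]

lemma natCast_add_one_add_X_ne_zero (n : ℕ) : (n : RatFunc ℂ) + 1 + RatFunc.X ≠ 0 := by
  have := RatFunc.algebraMap_ne_zero (Polynomial.X_add_C_ne_zero ((n : ℂ) + 1))
  rw [add_comm]
  simpa using this

lemma muStar_X_add_one_ne_zero : muStar ((RatFunc.X : RatFunc ℂ) + 1) ≠ 0 := by
  have h (c : ℂ) : (RatFunc.X : RatFunc ℂ) + RatFunc.C c ≠ 0 := by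
    have := RatFunc.algebraMap_ne_zero (Polynomial.X_add_C_ne_zero c)
    simpa using this
  have h6 (c : ℂ) (d : RatFunc ℂ) (hd : d = 6 * (RatFunc.X + RatFunc.C c)) : d ≠ 0 := by
    rw [hd]
    exact mul_ne_zero (by norm_num) (h c)
  refine div_ne_zero (mul_ne_zero (mul_ne_zero (by norm_num) (h6 (5 / 6) _ ?_))
    (h6 (13 / 6) _ ?_)) (mul_ne_zero ?_ ?_)
  · simp only [map_div₀, map_ofNat]
    ring
  · simp only [map_div₀, map_ofNat]
    ring
  · simpa using h 1
  · have := h 2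
    rw [map_ofNat] at this
    convert this using 1
    ring

theorem opPsi_shiftFormal_phiCoeff :
    opPsi shiftFormal (constSeries E₆DivSqrtDelta)
      (HahnSeries.C (muStar ((RatFunc.X : RatFunc ℂ) + 1))⁻¹) (formalSeries phiCoeff) = 0 := by
  have key := single_one_mul_phiTail_sub natCast_add_one_add_X_ne_zero muStar_X_add_one_ne_zero
    single_mul_constSeries_E₆DivSqrtDelta
  have e : shiftRatFunc (RatFunc.X + 1) = RatFunc.X + 2 := by
    rw [map_add, map_one, shiftRatFunc_X]
    ring
  rw [opPsi, formalSeries_phiCoeff, shiftFormal_inHalfPowers_phiTail, shiftFormal_single_mul,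
    shiftRatFunc_X, shiftFormal_inHalfPowers_phiTail, e]
  exact key

end FormalParameter

end

/-! ### The main theorem -/

theorem mainTheorem4 :
    -- the normalized extremal forms of depth `1` and weight `6 k + 2` exist and are unique
    (∀ k : ℕ, ∃! f : ℍ → ℂ, IsNormalizedExtremal 1 (6 * k + 2) f) ∧
    ∀ f : ℕ → ℍ → ℂ, (∀ k : ℕ, IsNormalizedExtremal 1 (6 * k + 2) (f k)) →
      -- the identity for families indexed by the integers `k ≥ 0`
      opPsi shiftFamily (fun _ => E₆DivSqrtDelta)
          (fun k => HahnSeries.C (muStar ((k : ℂ) + 1))⁻¹) (fun k => phiSeries (f k) k) = 0 ∧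
      -- the coefficients are given by unique rational functions of `k`
      (∃! α : ℕ → RatFunc ℚ, IsRationalExpansion (fun k => phiSeries (f k) k) α) ∧
      -- the identity with `k` an indeterminate
      ∀ α : ℕ → RatFunc ℚ, IsRationalExpansion (fun k => phiSeries (f k) k) α →
        opPsi shiftFormal (constSeries E₆DivSqrtDelta)
          (HahnSeries.C (muStar ((RatFunc.X : RatFunc ℂ) + 1))⁻¹) (formalSeries α) = 0 := by
  refine ⟨fun k => ⟨extremalForm k, isNormalizedExtremal_extremalForm k,
    fun f hf => hf.eq_extremalForm⟩, fun f hf => ?_⟩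
  obtain rfl : f = extremalForm := funext fun k => (hf k).eq_extremalForm
  refine ⟨opPsi_shiftFamily_extremalForm, ⟨phiCoeff, isRationalExpansion_phiCoeff,
    fun α hα => hα.unique isRationalExpansion_phiCoeff⟩, fun α hα => ?_⟩
  rw [hα.unique isRationalExpansion_phiCoeff]
  exact opPsi_shiftFormal_phiCoeff
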